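/- Let $X_1,\dots,X_n$ ($n\ge 1$) be independent random variables with values in a measurable space $(E,\mathcal E)$ and arbitrary respective laws $P_1^\star,\dots,P_n^\star$; put $\boldsymbol X=(X_1,\dots,X_n)$ and $\overline P^\star=\frac1n\sum_{i=1}^n P_i^\star$. For probabilities $P,Q$ on $E$ let $h^2(P,Q)=\frac12\int_E\big(\sqrt{dP/d\nu}-\sqrt{dQ/d\nu}\big)^2d\nu$, where $\nu$ is any measure dominating $P$ and $Q$. Let $\mathscr M$ be a family of probabilities $P=p\cdot\mu$ on $E$ having densities with respect to a common measure $\mu$, equipped with a $\sigma$-algebra $\mathcal A$ and a probability $\pi$ (the prior) on $(\mathscr M,\mathcal A)$. Let $\psi(x)=\frac{x-1}{x+1}$ for $x\in[0,+\infty)$, $\psi(+\infty)=1$, and for $P=p\cdot\mu$, $Q=q\cdot\mu$ in $\mathscr M$ let $t_{(P,Q)}=\frac12\psi\big(\sqrt{q/p}\big)$ with the conventions $0/0=1$ and $x/0=+\infty$ for $x>0$. Assume that $P\mapsto h^2(S,P)$ is $\mathcal A$-measurable on $\mathscr M$ for every probability $S$ on $E$, and that $(x,P,Q)\mapsto t_{(P,Q)}(x)$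 is $\mathcal E\otimes\mathcal A\otimes\mathcal A$-measurable. Let $\beta=\frac1{500}$, $c=\frac1{125}$, $\lambda=(1+c)\beta$. Put $\mathbf T(\boldsymbol X,P,Q)=\sum_{i=1}^n t_{(P,Q)}(X_i)$, $$\mathbf T(\boldsymbol X,P)=\frac{\int_{\mathscr M}\mathbf T(\boldsymbol X,P,Q)\,e^{\lambda\mathbf T(\boldsymbol X,P,Q)}\,d\pi(Q)}{\int_{\mathscr M}e^{\lambda\mathbf T(\boldsymbol X,P,Q)}\,d\pi(Q)},\qquad \frac{d\widehat\pi_{\boldsymbol X}}{d\pi}(P)=\frac{e^{-\beta\mathbf T(\boldsymbol X,P)}}{\int_{\mathscr M}e^{-\beta\mathbf T(\boldsymbol X,P')}\,d\pi(P')}.$$ For $P\in\mathscr M$ and $r>0$ let $\mathscr B(P,r)=\{Q\in\mathscr M:\ h^2(P,Q)\le r\}$ and $$r_n(\beta,P)=\inf\Big\{r\ge\frac{8000}{3n}:\ \frac{\pi(\mathscr B(P,2r'))}{\pi(\mathscr B(P,r'))}\le\exp\Big(\frac{3nr'}{8\cdot10^6}\Big)\ \text{for all } r'\ge r\Big\},$$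 with the conventions $a/0=+\infty$ for all $a\ge0$ and $\inf\varnothing=+\infty$. Then $\widehat\pi_{\boldsymbol X}$ is a probability on $(\mathscr M,\mathcal A)$ and, for every $\xi>0$, with probability at least $1-2e^{-\xi/2}$ (with respect to $\boldsymbol X$), a random $\widehat P$ drawn from $\widehat\pi_{\boldsymbol X}$ satisfies, with ($\widehat\pi_{\boldsymbol X}$-)probability at least $1-e^{-\xi/2}$, $$h^2(\overline P^\star,\widehat P)\le1694\Big\{\inf_{P\in\mathscr M}\big[h^2(\overline P^\star,P)+r_n(\beta,P)\big]+\frac{5334\,\xi}{n}\Big\}.$$ -/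

import Mathlib

open MeasureTheory ProbabilityTheory
open scoped ENNReal NNReal

namespace HellingerPosterior

noncomputable section

/-- The squared Hellinger distance `h²(P, Q) = ½ ∫ (√(dP/dν) - √(dQ/dν))² dν`, computed with the
dominating measure `ν = P + Q`. -/
def hellingerSq {E : Type*} [MeasurableSpace E] (P Q : Measure E) : ℝ :=
  1 / 2 * ∫ x, (√((P.rnDeriv (P + Q) x).toReal) - √((Q.rnDeriv (P + Q) x).toReal)) ^ 2 ∂(P + Q)

/-- The value of `h²(P, Q)` does not depend on the dominating measure. -/
theorem hellingerSq_eq {E : Type*} [MeasurableSpace E] (P Q μ : Measure E)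
    [IsFiniteMeasure P] [IsFiniteMeasure Q] [SigmaFinite μ] (hP : P ≪ μ) (hQ : Q ≪ μ) :
    hellingerSq P Q =
      1 / 2 * ∫ x, (√((P.rnDeriv μ x).toReal) - √((Q.rnDeriv μ x).toReal)) ^ 2 ∂μ := by
  have hPQ : P + Q ≪ μ := hP.add_left hQ
  have h1 : P ≪ P + Q := Measure.absolutelyContinuous_of_le (Measure.le_add_right le_rfl)
  have h2 : Q ≪ P + Q := Measure.absolutelyContinuous_of_le (Measure.le_add_left le_rfl)
  unfold hellingerSq
  rw [← integral_rnDeriv_smul hPQ]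
  congr 1
  apply integral_congr_ae
  filter_upwards [Measure.rnDeriv_mul_rnDeriv (κ := μ) h1,
    Measure.rnDeriv_mul_rnDeriv (κ := μ) h2] with x hx hy
  rw [← hx, ← hy]
  simp only [Pi.mul_apply, ENNReal.toReal_mul, smul_eq_mul]
  rw [Real.sqrt_mul ENNReal.toReal_nonneg, Real.sqrt_mul ENNReal.toReal_nonneg, ← sub_mul, mul_pow,
    Real.sq_sqrt ENNReal.toReal_nonneg, mul_comm]

/-- The average `n⁻¹ ∑ i, P i` of the measures `P 0, …, P (n - 1)`. -/
def avgMeasure {E : Type*} [MeasurableSpace E] {n : ℕ} (P : Fin n → Measure E) : Measure E :=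
  (n : ℝ≥0∞)⁻¹ • ∑ i, P i

/-- `ψ : [0, +∞] → [-1, 1]`, `ψ x = (x - 1) / (x + 1)` for finite `x` and `ψ (+∞) = 1`. -/
def psi (x : ℝ≥0∞) : ℝ :=
  if x = ⊤ then 1 else (x.toReal - 1) / (x.toReal + 1)

/-- The ratio `q / p` with the conventions `0 / 0 = 1` and `x / 0 = +∞` for `x > 0`. -/
def densityRatio (q p : ℝ≥0) : ℝ≥0∞ :=
  if q = 0 ∧ p = 0 then 1 else (q : ℝ≥0∞) / (p : ℝ≥0∞)

/-- The test function `t_{(P, Q)} = ½ ψ(√(q / p))`, where `p`, `q` are the densities of `P`, `Q`. -/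
def hellingerTest {E : Type*} (p q : E → ℝ≥0) (x : E) : ℝ :=
  1 / 2 * psi (densityRatio (q x) (p x) ^ (1 / 2 : ℝ))

section Posterior

variable {E 𝓜 : Type*} [MeasurableSpace 𝓜]

/-- `T(x, P, Q) = ∑ i, t_{(P, Q)} (x i)`. -/
def testSum (t : 𝓜 → 𝓜 → E → ℝ) {n : ℕ} (x : Fin n → E) (P Q : 𝓜) : ℝ :=
  ∑ i, t P Q (x i)

/-- The probability `π̃_x(· | P)`, with density proportional to `Q ↦ exp (lam * T(x, P, Q))` with
respect to the prior `π`. -/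
def innerPosterior (t : 𝓜 → 𝓜 → E → ℝ) (lam : ℝ) (π : Measure 𝓜) {n : ℕ} (x : Fin n → E)
    (P : 𝓜) : Measure 𝓜 :=
  π.tilted fun Q => lam * testSum t x P Q

/-- `T(x, P) = ∫ T(x, P, Q) dπ̃_x(Q | P)`. -/
def meanTest (t : 𝓜 → 𝓜 → E → ℝ) (lam : ℝ) (π : Measure 𝓜) {n : ℕ} (x : Fin n → E)
    (P : 𝓜) : ℝ :=
  ∫ Q, testSum t x P Q ∂(innerPosterior t lam π x P)

/-- The posterior `π̂_x` with parameters `β`, `c` (and `lam = (1 + c) * β`): its density with respect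
to the prior `π` is proportional to `P ↦ exp (-β * T(x, P))`. -/
def posterior (t : 𝓜 → 𝓜 → E → ℝ) (β c : ℝ) (π : Measure 𝓜) {n : ℕ} (x : Fin n → E) :
    Measure 𝓜 :=
  π.tilted fun P => -β * meanTest t ((1 + c) * β) π x P

variable [MeasurableSpace E]

/-- The ball `{Q ∈ 𝓜 | h²(S, Q) ≤ r}` of the model `𝓜`, given as a family `law` of measures. -/
def hellingerBall (law : 𝓜 → Measure E) (S : Measure E) (r : ℝ) : Set 𝓜 :=
  {Q | hellingerSq S (law Q) ≤ r}

/-- The ratio `π(B(P, 2r)) / π(B(P, r))`, with the convention `a / 0 = +∞` for all `a ≥ 0`. -/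
def priorRatio (law : 𝓜 → Measure E) (π : Measure 𝓜) (P : 𝓜) (r : ℝ) : ℝ≥0∞ :=
  if π (hellingerBall law (law P) r) = 0 then ⊤
  else π (hellingerBall law (law P) (2 * r)) / π (hellingerBall law (law P) r)

/-- `r_n(β, P)` for `β = 1 / 500`, as an infimum in `[0, +∞]` (so that `inf ∅ = +∞`). -/
def hellingerRadius (law : 𝓜 → Measure E) (π : Measure 𝓜) (n : ℕ) (P : 𝓜) : ℝ≥0∞ :=
  sInf (ENNReal.ofReal '' {r : ℝ | 8000 / (3 * (n : ℝ)) ≤ r ∧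
    ∀ r' : ℝ, r ≤ r' →
      priorRatio law π P r' ≤ ENNReal.ofReal (Real.exp (3 * (n : ℝ) * r' / (8 * 10 ^ 6)))})

end Posterior

end

end HellingerPosterior

namespace HellingerPosterior

noncomputable section

/-! The test is antisymmetric in `(P, Q)` and bounded by 1/2. Under any probability `S`, in the
model or not, its mean is at most 2h²(S,P) − (3/16)h²(S,Q) (`integral_hellingerTest_le`) and its
second moment at most h²(S,P) + h²(S,Q) (`integral_hellingerTest_sq_le`). Sums over the sample see
the marginals only through their average, so `S` is the averaged law. For small `u`, `v` the squared
terms are negligible. Hence E exp(uT(X,P,Q') − vT(X,P,Q)) decays exponentially in n h²(S,Q'), and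
also in n h²(S,P) when `v` is much larger than `u`, at the cost of a factor exponential in n h²(S,Q)
(`lintegral_exp_testSum_sub_le`).

The posterior is a Gibbs measure whose energy is itself a Gibbs mean. Jensen removes the inner mean,
and Cauchy–Schwarz on a ball `B` around a good model point turns every reciprocal normalisation into
an integral over `B`. The posterior mass of a set `A` is thereby at most a product of two triple
integrals divided by π(B)^6. Fubini bounds their expectations and Markov, applied to each, produces
the two exceptional events of `exists_posterior_le`.

The doubling condition on the prior makes ∫ exp(−κh²) dπ comparable to π(B)
(`lintegral_exp_neg_le_of_doubling`). All powers of π(B) then cancel, and what remains is small as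
soon as `A` consists of points far enough from `S`. -/

/-! ### Pointwise algebra of the test. -/

theorem hellingerTest_apply {E : Type*} (p q : E → ℝ≥0) (x : E) :
    hellingerTest p q x =
      1 / 2 * ((√(q x : ℝ) - √(p x : ℝ)) / (√(q x : ℝ) + √(p x : ℝ))) := by
  unfold hellingerTest densityRatio psi
  congr 1
  by_cases hp : p x = 0
  · by_cases hq : q x = 0
    · simp [hp, hq]
    · simp [hp, hq, ENNReal.div_zero]
  · have hp' : 0 < √(p x : ℝ) := by
      rw [Real.sqrt_pos]; exact_mod_cast pos_iff_ne_zero.mpr hp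
    have h1 : ((q x : ℝ≥0∞) / (p x : ℝ≥0∞)) = ((q x / p x : ℝ≥0) : ℝ≥0∞) := by
      rw [ENNReal.coe_div hp]
    have hc : ¬(q x = 0 ∧ p x = 0) := fun h => hp h.2
    rw [if_neg hc, h1, ← ENNReal.coe_rpow_of_nonneg _ (by norm_num),
      if_neg ENNReal.coe_ne_top, ENNReal.coe_toReal, NNReal.coe_rpow, NNReal.coe_div,
      ← Real.sqrt_eq_rpow, Real.sqrt_div (NNReal.coe_nonneg _)]
    have := Real.sqrt_nonneg (q x : ℝ)
    field_simp

theorem hellingerTest_swap {E : Type*} (p q : E → ℝ≥0) (x : E) :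
    hellingerTest q p x = -hellingerTest p q x := by
  rw [hellingerTest_apply, hellingerTest_apply, add_comm (√(p x : ℝ)), ← neg_sub, neg_div]
  ring

theorem hellingerTest_mul_add {E : Type*} (p q : E → ℝ≥0) (x : E) :
    hellingerTest p q x * (√(p x : ℝ) + √(q x : ℝ)) = 1 / 2 * (√(q x : ℝ) - √(p x : ℝ)) := by
  rw [hellingerTest_apply]
  have h1 := Real.sqrt_nonneg (p x : ℝ)
  have h2 := Real.sqrt_nonneg (q x : ℝ)
  rcases eq_or_ne (√(q x : ℝ) + √(p x : ℝ)) 0 with h | h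
  · have h3 : √(q x : ℝ) = 0 := by linarith
    have h4 : √(p x : ℝ) = 0 := by linarith
    simp [h3, h4]
  · field_simp
    ring

theorem abs_hellingerTest_le {E : Type*} (p q : E → ℝ≥0) (x : E) :
    |hellingerTest p q x| ≤ 1 / 2 := by
  rw [hellingerTest_apply, abs_mul, abs_of_pos (by norm_num : (0 : ℝ) < 1 / 2), abs_div]
  have h1 := Real.sqrt_nonneg (p x : ℝ)
  have h2 := Real.sqrt_nonneg (q x : ℝ)
  have h3 : |√(q x : ℝ) - √(p x : ℝ)| / |√(q x : ℝ) + √(p x : ℝ)| ≤ 1 := by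
    refine div_le_one_of_le₀ ?_ (abs_nonneg _)
    rw [abs_of_nonneg (add_nonneg h2 h1), abs_le]
    constructor <;> linarith
  linarith

theorem measurable_hellingerTest {E : Type*} [MeasurableSpace E] {p q : E → ℝ≥0}
    (hp : Measurable p) (hq : Measurable q) : Measurable (hellingerTest p q) := by
  have : hellingerTest p q = fun x =>
      1 / 2 * ((√(q x : ℝ) - √(p x : ℝ)) / (√(q x : ℝ) + √(p x : ℝ))) :=
    funext fun x => hellingerTest_apply p q x
  rw [this]
  fun_prop

/-- Pointwise form of the bound on the mean of the test. -/
theorem sq_mul_test_le {s a b t : ℝ} (hs : 0 ≤ s) (ha : 0 ≤ a) (hb : 0 ≤ b)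
    (ht : |t| ≤ 1 / 2) (h : t * (a + b) = 1 / 2 * (b - a)) :
    s ^ 2 * t ≤ (s - a) ^ 2 - 3 / 32 * (s - b) ^ 2 - 1 / 8 * (a ^ 2 - s ^ 2)
      + 1 / 8 * (b ^ 2 - s ^ 2) := by
  -- Where `P` and `Q` both vanish, `h` says nothing about `t`; the bound 1/2 alone suffices, as 1/2
  -- ≤ 1 − 3/32.
  rcases (add_nonneg ha hb).eq_or_lt with h0 | h0
  · have ha0 : a = 0 := by linarith
    have hb0 : b = 0 := by linarith
    subst ha0 hb0
    nlinarith [(abs_le.mp ht).2, sq_nonneg s]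
  · refine le_of_mul_le_mul_right ?_ h0
    rw [mul_assoc, h]
    nlinarith [mul_nonneg ha (sq_nonneg (a - s)), mul_nonneg hb (sq_nonneg (a - s)),
      mul_nonneg ha (sq_nonneg (b - s)), mul_nonneg hb (sq_nonneg (b - s)),
      mul_nonneg hs (sq_nonneg (a - s)), mul_nonneg hs (sq_nonneg (b - s)),
      mul_nonneg hs (sq_nonneg (a - b)), mul_nonneg ha (sq_nonneg (a - b)),
      mul_nonneg hb (sq_nonneg (a - b))]

/-- Pointwise form of the bound on the second moment of the test. -/
theorem sq_mul_test_sq_le {s a b t : ℝ} (hs : 0 ≤ s)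
    (ht : |t| ≤ 1 / 2) (h : t * (a + b) = 1 / 2 * (b - a)) :
    s ^ 2 * t ^ 2 ≤ 1 / 2 * (s - a) ^ 2 + 1 / 2 * (s - b) ^ 2 := by
  have ht2 : t ^ 2 ≤ 1 / 4 := by
    rw [← sq_abs]; nlinarith [abs_nonneg t]
  -- If s ≤ a + b, then `s * t` is dominated by (b − a)/2. Otherwise `s` exceeds a + b, which forces
  -- (s − a)² + (s − b)² ≥ s²/2.
  rcases le_total s (a + b) with h1 | h1
  · have h2 : s ^ 2 * t ^ 2 ≤ (t * (a + b)) ^ 2 := by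
      rw [mul_pow, mul_comm]
      gcongr
    rw [h] at h2
    nlinarith [sq_nonneg (2 * s - a - b)]
  · nlinarith [sq_nonneg (a - b), mul_le_mul_of_nonneg_left ht2 (sq_nonneg s)]

/-! ### Elementary properties of the Hellinger distance. -/

theorem hellingerSq_comm {E : Type*} [MeasurableSpace E] (P Q : Measure E) :
    hellingerSq P Q = hellingerSq Q P := by
  unfold hellingerSq
  rw [add_comm P Q]
  congr 2
  ext x
  ring

theorem hellingerSq_nonneg {E : Type*} [MeasurableSpace E] (P Q : Measure E) :
    0 ≤ hellingerSq P Q := by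
  unfold hellingerSq
  have : 0 ≤ ∫ x, (√((P.rnDeriv (P + Q) x).toReal) - √((Q.rnDeriv (P + Q) x).toReal)) ^ 2
      ∂(P + Q) := integral_nonneg fun x => sq_nonneg _
  linarith

theorem integrable_sqrt_rnDeriv_sub_sq {E : Type*} [MeasurableSpace E] (P Q ν : Measure E)
    [IsFiniteMeasure P] [IsFiniteMeasure Q] :
    Integrable (fun x => (√((P.rnDeriv ν x).toReal) - √((Q.rnDeriv ν x).toReal)) ^ 2) ν := by
  have hP : Integrable (fun x => (P.rnDeriv ν x).toReal) ν := Measure.integrable_toReal_rnDeriv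
  have hQ : Integrable (fun x => (Q.rnDeriv ν x).toReal) ν := Measure.integrable_toReal_rnDeriv
  refine (hP.add hQ).mono' ?_ (Filter.Eventually.of_forall fun x => ?_)
  · have h1 := Measure.measurable_rnDeriv P ν
    have h2 := Measure.measurable_rnDeriv Q ν
    exact Measurable.aestronglyMeasurable (by fun_prop)
  · have h1 := Real.sq_sqrt (ENNReal.toReal_nonneg (a := P.rnDeriv ν x))
    have h2 := Real.sq_sqrt (ENNReal.toReal_nonneg (a := Q.rnDeriv ν x))
    rw [Real.norm_of_nonneg (sq_nonneg _)]
    simp only [Pi.add_apply]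
    nlinarith [mul_nonneg (Real.sqrt_nonneg (P.rnDeriv ν x).toReal)
      (Real.sqrt_nonneg (Q.rnDeriv ν x).toReal)]

/-- Pointwise (a − c)² ≤ 2(a − b)² + 2(b − c)², with densities taken with respect to P + Q + R. This
weak triangle inequality is the only one needed. -/
theorem hellingerSq_le_two_mul_add {E : Type*} [MeasurableSpace E] (P Q R : Measure E)
    [IsFiniteMeasure P] [IsFiniteMeasure Q] [IsFiniteMeasure R] :
    hellingerSq P R ≤ 2 * hellingerSq P Q + 2 * hellingerSq Q R := by
  have hP : P ≪ P + Q + R := Measure.absolutelyContinuous_of_le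
    (Measure.le_add_right (Measure.le_add_right le_rfl))
  have hQ : Q ≪ P + Q + R := Measure.absolutelyContinuous_of_le
    (Measure.le_add_right (Measure.le_add_left le_rfl))
  have hR : R ≪ P + Q + R := Measure.absolutelyContinuous_of_le (Measure.le_add_left le_rfl)
  rw [hellingerSq_eq P R _ hP hR, hellingerSq_eq P Q _ hP hQ, hellingerSq_eq Q R _ hQ hR]
  have key := integral_mono (integrable_sqrt_rnDeriv_sub_sq P R (P + Q + R))
    (((integrable_sqrt_rnDeriv_sub_sq P Q (P + Q + R)).const_mul 2).add
      ((integrable_sqrt_rnDeriv_sub_sq Q R (P + Q + R)).const_mul 2)) (fun x => by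
        simp only [Pi.add_apply]
        nlinarith [sq_nonneg (√((P.rnDeriv (P + Q + R) x).toReal)
          - 2 * √((Q.rnDeriv (P + Q + R) x).toReal) + √((R.rnDeriv (P + Q + R) x).toReal))])
  rw [integral_add' ((integrable_sqrt_rnDeriv_sub_sq P Q (P + Q + R)).const_mul 2)
    ((integrable_sqrt_rnDeriv_sub_sq Q R (P + Q + R)).const_mul 2),
    integral_const_mul, integral_const_mul] at key
  linarith

/-! ### Mean and second moment of the test under an arbitrary probability. -/

/-- The test is a function of the ratio of the densities with respect to any dominating measure. -/
theorem hellingerTest_mul_sqrt_rnDeriv {E : Type*} [MeasurableSpace E] {p q : E → ℝ≥0}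
    (hp : Measurable p) (hq : Measurable q) {μ P Q ν : Measure E}
    [IsFiniteMeasure P] [IsFiniteMeasure Q] [IsFiniteMeasure ν]
    (hP : P = μ.withDensity fun x => (p x : ℝ≥0∞)) (hQ : Q = μ.withDensity fun x => (q x : ℝ≥0∞))
    (hPν : P ≪ ν) (hQν : Q ≪ ν) :
    ∀ᵐ x ∂ν, hellingerTest p q x *
      (√((P.rnDeriv ν x).toReal) + √((Q.rnDeriv ν x).toReal)) =
      1 / 2 * (√((Q.rnDeriv ν x).toReal) - √((P.rnDeriv ν x).toReal)) := by
  have hsum : P + Q = μ.withDensity fun x => ((p x + q x : ℝ≥0) : ℝ≥0∞) := by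
    rw [hP, hQ, ← withDensity_add_left (by fun_prop)]
    congr 1
  -- `μ` need not be σ-finite, nor comparable with `ν`, so densities are compared through `P + Q`:
  -- dF/dν = d(P+Q)/dν · f/(p+q). The division by zero is harmless because `f ≤ p + q`.
  have key : ∀ (f : E → ℝ≥0), Measurable f → (∀ x, f x ≤ p x + q x) → ∀ F : Measure E,
      F = μ.withDensity (fun x => (f x : ℝ≥0∞)) →
      F.rnDeriv ν =ᵐ[ν] fun x => (P + Q).rnDeriv ν x * ((f x / (p x + q x) : ℝ≥0) : ℝ≥0∞) := by
    intro f hf hfle F hF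
    have h1 : F = ν.withDensity
        ((P + Q).rnDeriv ν * fun x => ((f x / (p x + q x) : ℝ≥0) : ℝ≥0∞)) := by
      rw [withDensity_mul _ (Measure.measurable_rnDeriv _ _) (by fun_prop),
        Measure.withDensity_rnDeriv_eq _ _ (hPν.add_left hQν), hsum,
        ← withDensity_mul _ (by fun_prop) (by fun_prop), hF]
      congr 1
      ext x
      simp only [Pi.mul_apply]
      rw [← ENNReal.coe_mul]
      congr 1
      rw [mul_div_cancel_of_imp']
      intro h
      have := hfle x
      rw [h] at this
      exact le_antisymm this zero_le
    nth_rewrite 1 [h1]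
    exact Measure.rnDeriv_withDensity ν
      ((Measure.measurable_rnDeriv _ _).mul (by fun_prop))
  filter_upwards [key p hp (fun x => le_self_add) P hP, key q hq (fun x => le_add_self) Q hQ]
    with x hx hy
  rw [hx, hy]
  simp only [ENNReal.toReal_mul, ENNReal.coe_toReal, NNReal.coe_div]
  rw [Real.sqrt_mul ENNReal.toReal_nonneg, Real.sqrt_mul ENNReal.toReal_nonneg,
    Real.sqrt_div NNReal.zero_le_coe, Real.sqrt_div NNReal.zero_le_coe]
  have := hellingerTest_mul_add p q x
  linear_combination √((P + Q).rnDeriv ν x).toReal * (√((p x + q x : ℝ≥0) : ℝ))⁻¹ * this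

theorem integrable_hellingerTest {E : Type*} [MeasurableSpace E] {p q : E → ℝ≥0}
    (hp : Measurable p) (hq : Measurable q) (S : Measure E) [IsFiniteMeasure S] :
    Integrable (hellingerTest p q) S :=
  Integrable.of_bound (measurable_hellingerTest hp hq).aestronglyMeasurable (1 / 2)
    (Filter.Eventually.of_forall fun x => abs_hellingerTest_le p q x)

theorem integral_toReal_rnDeriv_eq_one {E : Type*} [MeasurableSpace E] {P ν : Measure E}
    [IsProbabilityMeasure P] [SigmaFinite ν] (h : P ≪ ν) :
    ∫ x, (P.rnDeriv ν x).toReal ∂ν = 1 := by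
  rw [Measure.integral_toReal_rnDeriv h]
  simp

theorem integral_hellingerTest_le {E : Type*} [MeasurableSpace E] {p q : E → ℝ≥0}
    (hp : Measurable p) (hq : Measurable q) {μ P Q : Measure E} (S : Measure E)
    [IsProbabilityMeasure P] [IsProbabilityMeasure Q] [IsProbabilityMeasure S]
    (hP : P = μ.withDensity fun x => (p x : ℝ≥0∞))
    (hQ : Q = μ.withDensity fun x => (q x : ℝ≥0∞)) :
    ∫ x, hellingerTest p q x ∂S ≤ 2 * hellingerSq S P - 3 / 16 * hellingerSq S Q := by
  obtain ⟨ν, hνdef⟩ : ∃ ν, ν = S + P + Q := ⟨_, rfl⟩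
  have hν : IsFiniteMeasure ν := by rw [hνdef]; infer_instance
  have hSν : S ≪ ν := hνdef ▸ Measure.absolutelyContinuous_of_le
    (Measure.le_add_right (Measure.le_add_right le_rfl))
  have hPν : P ≪ ν := hνdef ▸ Measure.absolutelyContinuous_of_le
    (Measure.le_add_right (Measure.le_add_left le_rfl))
  have hQν : Q ≪ ν := hνdef ▸ Measure.absolutelyContinuous_of_le (Measure.le_add_left le_rfl)
  rw [hellingerSq_eq S P ν hSν hPν, hellingerSq_eq S Q ν hSν hQν, ← integral_rnDeriv_smul hSν]
  have hi1 := integrable_sqrt_rnDeriv_sub_sq S P ν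
  have hi2 := integrable_sqrt_rnDeriv_sub_sq S Q ν
  have hiP : Integrable (fun x => (P.rnDeriv ν x).toReal) ν := Measure.integrable_toReal_rnDeriv
  have hiQ : Integrable (fun x => (Q.rnDeriv ν x).toReal) ν := Measure.integrable_toReal_rnDeriv
  have hi12 : Integrable (fun x => (√((S.rnDeriv ν x).toReal) - √((P.rnDeriv ν x).toReal)) ^ 2 -
      3 / 32 * (√((S.rnDeriv ν x).toReal) - √((Q.rnDeriv ν x).toReal)) ^ 2) ν :=
    hi1.sub (hi2.const_mul _)
  have hi3 : Integrable (fun x => 1 / 8 * ((Q.rnDeriv ν x).toReal - (P.rnDeriv ν x).toReal)) ν :=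
    (hiQ.sub hiP).const_mul _
  have key : ∫ x, (S.rnDeriv ν x).toReal • hellingerTest p q x ∂ν ≤
      ∫ x, (((√((S.rnDeriv ν x).toReal) - √((P.rnDeriv ν x).toReal)) ^ 2 -
        3 / 32 * (√((S.rnDeriv ν x).toReal) - √((Q.rnDeriv ν x).toReal)) ^ 2) +
        1 / 8 * ((Q.rnDeriv ν x).toReal - (P.rnDeriv ν x).toReal)) ∂ν := by
    refine integral_mono_ae ?_ (hi12.add hi3) ?_
    · exact (integrable_rnDeriv_smul_iff hSν).mpr (integrable_hellingerTest hp hq S)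
    · filter_upwards [hellingerTest_mul_sqrt_rnDeriv hp hq hP hQ hPν hQν] with x hx
      have h := sq_mul_test_le (Real.sqrt_nonneg (S.rnDeriv ν x).toReal)
        (Real.sqrt_nonneg (P.rnDeriv ν x).toReal) (Real.sqrt_nonneg (Q.rnDeriv ν x).toReal)
        (abs_hellingerTest_le p q x) hx
      rw [Real.sq_sqrt ENNReal.toReal_nonneg, Real.sq_sqrt ENNReal.toReal_nonneg,
        Real.sq_sqrt ENNReal.toReal_nonneg] at h
      rw [smul_eq_mul]
      linarith
  -- The 1/8 correction integrates to zero because `P` and `Q` have the same total mass.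
  rw [integral_add hi12 hi3,
    integral_sub hi1 (hi2.const_mul _), integral_const_mul, integral_const_mul,
    integral_sub hiQ hiP, integral_toReal_rnDeriv_eq_one hPν,
    integral_toReal_rnDeriv_eq_one hQν] at key
  linarith

theorem integral_hellingerTest_sq_le {E : Type*} [MeasurableSpace E] {p q : E → ℝ≥0}
    (hp : Measurable p) (hq : Measurable q) {μ P Q : Measure E} (S : Measure E)
    [IsFiniteMeasure P] [IsFiniteMeasure Q] [IsFiniteMeasure S]
    (hP : P = μ.withDensity fun x => (p x : ℝ≥0∞))
    (hQ : Q = μ.withDensity fun x => (q x : ℝ≥0∞)) :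
    ∫ x, hellingerTest p q x ^ 2 ∂S ≤ hellingerSq S P + hellingerSq S Q := by
  obtain ⟨ν, hνdef⟩ : ∃ ν, ν = S + P + Q := ⟨_, rfl⟩
  have hν : IsFiniteMeasure ν := by rw [hνdef]; infer_instance
  have hSν : S ≪ ν := hνdef ▸ Measure.absolutelyContinuous_of_le
    (Measure.le_add_right (Measure.le_add_right le_rfl))
  have hPν : P ≪ ν := hνdef ▸ Measure.absolutelyContinuous_of_le
    (Measure.le_add_right (Measure.le_add_left le_rfl))
  have hQν : Q ≪ ν := hνdef ▸ Measure.absolutelyContinuous_of_le (Measure.le_add_left le_rfl)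
  rw [hellingerSq_eq S P ν hSν hPν, hellingerSq_eq S Q ν hSν hQν, ← integral_rnDeriv_smul hSν,
    ← integral_const_mul, ← integral_const_mul]
  have hi1 := (integrable_sqrt_rnDeriv_sub_sq S P ν).const_mul (1 / 2)
  have hi2 := (integrable_sqrt_rnDeriv_sub_sq S Q ν).const_mul (1 / 2)
  rw [← integral_add hi1 hi2]
  refine integral_mono_of_nonneg (Filter.Eventually.of_forall fun x =>
    smul_nonneg ENNReal.toReal_nonneg (sq_nonneg _)) (hi1.add hi2) ?_
  filter_upwards [hellingerTest_mul_sqrt_rnDeriv hp hq hP hQ hPν hQν] with x hx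
  have h := sq_mul_test_sq_le (Real.sqrt_nonneg (S.rnDeriv ν x).toReal)
    (abs_hellingerTest_le p q x) hx
  rwa [Real.sq_sqrt ENNReal.toReal_nonneg] at h

/-! ### Exponential moments over the independent sample. -/

theorem sum_integral_eq_avgMeasure {E : Type*} [MeasurableSpace E] {n : ℕ} (hn : 0 < n)
    (P : Fin n → Measure E) {f : E → ℝ} (hf : ∀ i, Integrable f (P i)) :
    ∑ i, ∫ x, f x ∂(P i) = n * ∫ x, f x ∂(avgMeasure P) := by
  have hn' : (n : ℝ) ≠ 0 := by positivity
  unfold avgMeasure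
  rw [integral_smul_measure, integral_finsetSum_measure fun i _ => hf i]
  simp [hn']

theorem isProbabilityMeasure_avgMeasure {E : Type*} [MeasurableSpace E] {n : ℕ} (hn : 0 < n)
    (P : Fin n → Measure E) [∀ i, IsProbabilityMeasure (P i)] :
    IsProbabilityMeasure (avgMeasure P) := by
  constructor
  simp only [avgMeasure, Measure.smul_apply, Measure.coe_finsetSum, Finset.sum_apply, measure_univ,
    Finset.sum_const, Finset.card_univ, Fintype.card_fin, nsmul_eq_mul, mul_one, smul_eq_mul]
  exact ENNReal.inv_mul_cancel (by exact_mod_cast hn.ne') (ENNReal.natCast_ne_top n)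

/-- Combines exp y ≤ 1 + y + y² for |y| ≤ 1 with 1 + y ≤ exp y. -/
theorem integral_exp_le_exp_of_abs_le_one {E : Type*} [MeasurableSpace E] (P : Measure E)
    [IsProbabilityMeasure P] {f : E → ℝ} (hf : Measurable f) (hf1 : ∀ x, |f x| ≤ 1) :
    ∫ x, Real.exp (f x) ∂P ≤ Real.exp (∫ x, f x ∂P + ∫ x, f x ^ 2 ∂P) := by
  have hi : Integrable f P :=
    Integrable.of_bound hf.aestronglyMeasurable 1 (Filter.Eventually.of_forall hf1)
  have hi2 : Integrable (fun x => f x ^ 2) P :=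
    Integrable.of_bound (hf.pow_const 2).aestronglyMeasurable 1
      (Filter.Eventually.of_forall fun x => by
        rw [Real.norm_eq_abs, abs_pow]; exact pow_le_one₀ (abs_nonneg _) (hf1 x))
  have h1 : ∫ x, Real.exp (f x) ∂P ≤ ∫ x, (1 + f x + f x ^ 2) ∂P := by
    refine integral_mono_of_nonneg (Filter.Eventually.of_forall fun x => (Real.exp_pos _).le)
      (((integrable_const 1).add hi).add hi2) (Filter.Eventually.of_forall fun x => ?_)
    have := (abs_le.mp (Real.abs_exp_sub_one_sub_id_le (hf1 x))).2
    simp only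
    linarith
  have h2 : ∫ x, (1 + f x + f x ^ 2) ∂P = 1 + ∫ x, f x ∂P + ∫ x, f x ^ 2 ∂P := by
    have h3 : Integrable (fun x => 1 + f x) P := (integrable_const 1).add hi
    rw [integral_add h3 hi2, integral_add (integrable_const 1) hi]
    simp
  rw [h2] at h1
  have := Real.add_one_le_exp (∫ x, f x ∂P + ∫ x, f x ^ 2 ∂P)
  linarith

theorem lintegral_exp_sum_le {E : Type*} [MeasurableSpace E] {n : ℕ} (hn : 0 < n)
    (P : Fin n → Measure E) [∀ i, IsProbabilityMeasure (P i)] {f : E → ℝ} (hf : Measurable f)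
    (hf1 : ∀ x, |f x| ≤ 1) :
    ∫⁻ x, ENNReal.ofReal (Real.exp (∑ i, f (x i))) ∂(Measure.pi P) ≤
      ENNReal.ofReal (Real.exp
        (n * (∫ x, f x ∂(avgMeasure P) + ∫ x, f x ^ 2 ∂(avgMeasure P)))) := by
  have hi : ∀ i, Integrable f (P i) := fun i =>
    Integrable.of_bound hf.aestronglyMeasurable 1 (Filter.Eventually.of_forall hf1)
  have hi2 : ∀ i, Integrable (fun x => f x ^ 2) (P i) := fun i =>
    Integrable.of_bound (hf.pow_const 2).aestronglyMeasurable 1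
      (Filter.Eventually.of_forall fun x => by
        rw [Real.norm_eq_abs, abs_pow]; exact pow_le_one₀ (abs_nonneg _) (hf1 x))
  have hexp : ∀ i, Integrable (fun x => Real.exp (f x)) (P i) := fun i =>
    Integrable.of_bound hf.exp.aestronglyMeasurable (Real.exp 1)
      (Filter.Eventually.of_forall fun x => by
        rw [Real.norm_of_nonneg (Real.exp_pos _).le]
        exact Real.exp_le_exp.mpr ((le_abs_self _).trans (hf1 x)))
  simp_rw [Real.exp_sum]
  rw [← ofReal_integral_eq_lintegral_ofReal (Integrable.fintype_prod hexp)
    (Filter.Eventually.of_forall fun x => Finset.prod_nonneg fun i _ => (Real.exp_pos _).le)]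
  refine ENNReal.ofReal_le_ofReal ?_
  rw [integral_fintype_prod_eq_prod (fun _ x => Real.exp (f x)), mul_add,
    ← sum_integral_eq_avgMeasure hn P hi, ← sum_integral_eq_avgMeasure hn P hi2,
    ← Finset.sum_add_distrib, Real.exp_sum]
  exact Finset.prod_le_prod (fun i _ => integral_nonneg fun x => (Real.exp_pos _).le)
    fun i _ => integral_exp_le_exp_of_abs_le_one (P i) hf hf1

/-- By antisymmetry −T(x,P,Q) = T(x,Q,P), so both terms are upper-bounded by the same mean estimate.
The condition `u + v ≤ 2` keeps each summand in [−1, 1]. -/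
theorem lintegral_exp_testSum_sub_le {E : Type*} [MeasurableSpace E] {n : ℕ} (hn : 0 < n)
    (Pstar : Fin n → Measure E) [∀ i, IsProbabilityMeasure (Pstar i)] {𝓜 : Type*}
    (law : 𝓜 → Measure E) [∀ P, IsProbabilityMeasure (law P)]
    (μ : Measure E) (p : 𝓜 → E → ℝ≥0) (hp : ∀ P, Measurable (p P))
    (hlaw : ∀ P, law P = μ.withDensity fun x => (p P x : ℝ≥0∞))
    {u v : ℝ} (hu : 0 ≤ u) (hv : 0 ≤ v) (huv : u + v ≤ 2) (P Q Q' : 𝓜) :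
    ∫⁻ x, ENNReal.ofReal (Real.exp
        (u * testSum (fun P Q => hellingerTest (p P) (p Q)) x P Q'
          - v * testSum (fun P Q => hellingerTest (p P) (p Q)) x P Q)) ∂(Measure.pi Pstar) ≤
      ENNReal.ofReal (Real.exp (n *
        (u * (2 * hellingerSq (avgMeasure Pstar) (law P)
            - 3 / 16 * hellingerSq (avgMeasure Pstar) (law Q'))
          + v * (2 * hellingerSq (avgMeasure Pstar) (law Q)
            - 3 / 16 * hellingerSq (avgMeasure Pstar) (law P))
          + 2 * u ^ 2 * (hellingerSq (avgMeasure Pstar) (law P)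
            + hellingerSq (avgMeasure Pstar) (law Q'))
          + 2 * v ^ 2 * (hellingerSq (avgMeasure Pstar) (law P)
            + hellingerSq (avgMeasure Pstar) (law Q))))) := by
  have hS := isProbabilityMeasure_avgMeasure hn Pstar
  set S := avgMeasure Pstar
  have hm1 := measurable_hellingerTest (hp P) (hp Q')
  have hm2 := measurable_hellingerTest (hp Q) (hp P)
  have hi1 := integrable_hellingerTest (hp P) (hp Q') S
  have hi2 := integrable_hellingerTest (hp Q) (hp P) S
  have hb1 := abs_hellingerTest_le (p P) (p Q')
  have hb2 := abs_hellingerTest_le (p Q) (p P)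
  have hsq : ∀ {f : E → ℝ}, Measurable f → (∀ x, |f x| ≤ 1 / 2) →
      Integrable (fun x => f x ^ 2) S := fun hf hb =>
    Integrable.of_bound (hf.pow_const 2).aestronglyMeasurable 1
      (Filter.Eventually.of_forall fun x => by
        rw [Real.norm_eq_abs, abs_pow]
        exact pow_le_one₀ (abs_nonneg _) ((hb x).trans (by norm_num)))
  have hs1 := hsq hm1 hb1
  have hs2 := hsq hm2 hb2
  have hrw : ∀ x : Fin n → E, u * testSum (fun P Q => hellingerTest (p P) (p Q)) x P Q'
      - v * testSum (fun P Q => hellingerTest (p P) (p Q)) x P Q =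
      ∑ i, (u * hellingerTest (p P) (p Q') (x i) + v * hellingerTest (p Q) (p P) (x i)) := by
    intro x
    simp only [testSum]
    rw [Finset.sum_add_distrib, ← Finset.mul_sum, ← Finset.mul_sum]
    simp_rw [hellingerTest_swap (p P) (p Q)]
    rw [Finset.sum_neg_distrib]
    ring
  simp_rw [hrw]
  have hmf : Measurable fun x =>
      u * hellingerTest (p P) (p Q') x + v * hellingerTest (p Q) (p P) x :=
    (hm1.const_mul u).add (hm2.const_mul v)
  refine (lintegral_exp_sum_le hn Pstar hmf fun x => ?_).trans
    (ENNReal.ofReal_le_ofReal (Real.exp_le_exp.mpr ?_))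
  · have h1 := abs_le.mp (hb1 x)
    have h2 := abs_le.mp (hb2 x)
    rw [abs_le]
    constructor <;> nlinarith
  · refine mul_le_mul_of_nonneg_left ?_ (Nat.cast_nonneg n)
    have e1 := integral_hellingerTest_le (hp P) (hp Q') S (hlaw P) (hlaw Q')
    have e2 := integral_hellingerTest_le (hp Q) (hp P) S (hlaw Q) (hlaw P)
    have e3 := integral_hellingerTest_sq_le (hp P) (hp Q') S (hlaw P) (hlaw Q')
    have e4 := integral_hellingerTest_sq_le (hp Q) (hp P) S (hlaw Q) (hlaw P)
    have e5 : ∫ x, (u * hellingerTest (p P) (p Q') x + v * hellingerTest (p Q) (p P) x) ^ 2 ∂S ≤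
        2 * u ^ 2 * ∫ x, hellingerTest (p P) (p Q') x ^ 2 ∂S +
        2 * v ^ 2 * ∫ x, hellingerTest (p Q) (p P) x ^ 2 ∂S := by
      rw [← integral_const_mul, ← integral_const_mul,
        ← integral_add (hs1.const_mul _) (hs2.const_mul _)]
      refine integral_mono_of_nonneg (Filter.Eventually.of_forall fun x => sq_nonneg _)
        ((hs1.const_mul _).add (hs2.const_mul _)) (Filter.Eventually.of_forall fun x => ?_)
      simp only
      nlinarith [sq_nonneg (u * hellingerTest (p P) (p Q') x - v * hellingerTest (p Q) (p P) x)]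
    rw [integral_add (hi1.const_mul u) (hi2.const_mul v), integral_const_mul, integral_const_mul]
    have f1 := mul_le_mul_of_nonneg_left e1 hu
    have f2 := mul_le_mul_of_nonneg_left e2 hv
    have f3 := mul_le_mul_of_nonneg_left e3 (by positivity : 0 ≤ 2 * u ^ 2)
    have f4 := mul_le_mul_of_nonneg_left e4 (by positivity : 0 ≤ 2 * v ^ 2)
    linarith

/-! ### Jensen and Cauchy–Schwarz for Gibbs measures. -/

theorem integrable_exp_of_abs_le {α : Type*} [MeasurableSpace α] (ρ : Measure α)
    [IsFiniteMeasure ρ] {g : α → ℝ} (hg : Measurable g) {C : ℝ} (hC : ∀ x, |g x| ≤ C) :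
    Integrable (fun x => Real.exp (g x)) ρ :=
  Integrable.of_bound hg.exp.aestronglyMeasurable (Real.exp C)
    (Filter.Eventually.of_forall fun x => by
      rw [Real.norm_of_nonneg (Real.exp_pos _).le]
      exact Real.exp_le_exp.mpr ((le_abs_self _).trans (hC x)))

/-- Cauchy–Schwarz for exp(g/2) and exp(−g/2), proved by optimising over `s` the integral of the
square of s·exp(g/2) − exp(−g/2). -/
theorem sq_measureReal_univ_le_integral_exp_mul {α : Type*} [MeasurableSpace α] (ρ : Measure α)
    [IsFiniteMeasure ρ] {g : α → ℝ} (hg : Measurable g) {C : ℝ} (hC : ∀ x, |g x| ≤ C) :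
    ρ.real Set.univ ^ 2 ≤ (∫ x, Real.exp (g x) ∂ρ) * ∫ x, Real.exp (-g x) ∂ρ := by
  have h1 := integrable_exp_of_abs_le ρ hg hC
  have h2 : Integrable (fun x => Real.exp (-g x)) ρ :=
    integrable_exp_of_abs_le ρ hg.neg (C := C) fun x => by simpa using hC x
  have hA : 0 ≤ ∫ x, Real.exp (g x) ∂ρ := integral_nonneg fun x => (Real.exp_pos _).le
  have hB : 0 ≤ ∫ x, Real.exp (-g x) ∂ρ := integral_nonneg fun x => (Real.exp_pos _).le
  rcases (measureReal_nonneg (μ := ρ) (s := Set.univ)).eq_or_lt with h0 | h0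
  · rw [← h0]
    simpa using mul_nonneg hA hB
  have key : ∀ s : ℝ, 2 * s * ρ.real Set.univ ≤
      s ^ 2 * (∫ x, Real.exp (g x) ∂ρ) + ∫ x, Real.exp (-g x) ∂ρ := by
    intro s
    rw [← integral_const_mul, ← integral_add (h1.const_mul _) h2]
    have h3 : 2 * s * ρ.real Set.univ = ∫ _, 2 * s ∂ρ := by
      rw [integral_const, smul_eq_mul, mul_comm]
    rw [h3]
    refine integral_mono (integrable_const _) ((h1.const_mul _).add h2) fun x => ?_
    have e1 : Real.exp (g x) = Real.exp (g x / 2) ^ 2 := by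
      rw [← Real.exp_nat_mul]; congr 1; push_cast; ring
    have e2 : Real.exp (-g x) = Real.exp (-(g x / 2)) ^ 2 := by
      rw [← Real.exp_nat_mul]; congr 1; push_cast; ring
    have e3 : Real.exp (g x / 2) * Real.exp (-(g x / 2)) = 1 := by
      rw [← Real.exp_add]; simp
    have e4 : s * Real.exp (g x / 2) * Real.exp (-(g x / 2)) = s := by rw [mul_assoc, e3, mul_one]
    simp only
    rw [e1, e2]
    nlinarith [sq_nonneg (s * Real.exp (g x / 2) - Real.exp (-(g x / 2)))]
  have hA' : 0 < ∫ x, Real.exp (g x) ∂ρ := by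
    refine hA.lt_of_ne fun h => ?_
    -- If the first integral vanished, this `s` would turn `key` into b + 1 ≤ b, where b is the
    -- second integral.
    have := key ((∫ x, Real.exp (-g x) ∂ρ + 1) / (2 * ρ.real Set.univ))
    rw [← h, mul_zero, zero_add, mul_comm 2, mul_assoc, div_mul_cancel₀ _ (by positivity)] at this
    linarith
  have := key (ρ.real Set.univ / ∫ x, Real.exp (g x) ∂ρ)
  rw [div_pow] at this
  have e : ρ.real Set.univ ^ 2 / (∫ x, Real.exp (g x) ∂ρ) ≤ ∫ x, Real.exp (-g x) ∂ρ := by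
    have e1 : 2 * (ρ.real Set.univ / ∫ x, Real.exp (g x) ∂ρ) * ρ.real Set.univ =
      2 * (ρ.real Set.univ ^ 2 / ∫ x, Real.exp (g x) ∂ρ) := by ring
    have e2 : ρ.real Set.univ ^ 2 / (∫ x, Real.exp (g x) ∂ρ) ^ 2 * (∫ x, Real.exp (g x) ∂ρ) =
      ρ.real Set.univ ^ 2 / ∫ x, Real.exp (g x) ∂ρ := by field_simp
    linarith
  rwa [div_le_iff₀' hA'] at e

/-- Shrinking the domain to `B` before Cauchy–Schwarz is what localises the normalising constants
near a good model point. -/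
theorem inv_integral_exp_le {α : Type*} [MeasurableSpace α] (π : Measure α)
    [IsFiniteMeasure π] {g : α → ℝ} (hg : Measurable g) {C : ℝ} (hC : ∀ x, |g x| ≤ C)
    {B : Set α} (hB : π B ≠ 0) :
    (∫ x, Real.exp (g x) ∂π)⁻¹ ≤ (∫ x in B, Real.exp (-g x) ∂π) / π.real B ^ 2 := by
  have h1 := sq_measureReal_univ_le_integral_exp_mul (π.restrict B) hg hC
  have hV : 0 < π.real B := ENNReal.toReal_pos hB (measure_ne_top _ _)
  simp only [measureReal_restrict_apply_univ] at h1
  have hpos : 0 < ∫ x in B, Real.exp (g x) ∂π := by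
    refine (integral_nonneg fun x => (Real.exp_pos _).le : 0 ≤ ∫ x in B, Real.exp (g x) ∂π).lt_of_ne
      fun h => ?_
    rw [← h, zero_mul] at h1
    exact absurd h1 (not_le.mpr (by positivity))
  have h2 : ∫ x in B, Real.exp (g x) ∂π ≤ ∫ x, Real.exp (g x) ∂π :=
    setIntegral_le_integral (integrable_exp_of_abs_le π hg hC)
      (Filter.Eventually.of_forall fun x => (Real.exp_pos _).le)
  calc (∫ x, Real.exp (g x) ∂π)⁻¹ ≤ (∫ x in B, Real.exp (g x) ∂π)⁻¹ := inv_anti₀ hpos h2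
    _ ≤ _ := by
      rw [le_div_iff₀ (by positivity), inv_mul_le_iff₀ hpos]
      exact h1

/-- Jensen for the exponential under the tilted law. The price of removing the mean is a shift of
the tilt from `lam` to `lam + θ`. -/
theorem exp_mul_integral_tilted_le {α : Type*} [MeasurableSpace α] (π : Measure α)
    [IsProbabilityMeasure π] {g : α → ℝ} (hg : Measurable g) {C : ℝ} (hC : ∀ x, |g x| ≤ C)
    (lam θ : ℝ) :
    Real.exp (θ * ∫ x, g x ∂(π.tilted fun x => lam * g x)) ≤
      (∫ x, Real.exp ((lam + θ) * g x) ∂π) * (∫ x, Real.exp (lam * g x) ∂π)⁻¹ := by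
  have hmul : ∀ a : ℝ, ∀ x, |a * g x| ≤ |a| * C := fun a x => by
    rw [abs_mul]; exact mul_le_mul_of_nonneg_left (hC x) (abs_nonneg _)
  have hp : IsProbabilityMeasure (π.tilted fun x => lam * g x) :=
    isProbabilityMeasure_tilted (integrable_exp_of_abs_le π (hg.const_mul lam) (hmul lam))
  rw [← integral_const_mul]
  have h1 : Real.exp (∫ x, θ * g x ∂(π.tilted fun x => lam * g x)) ≤
      ∫ x, Real.exp (θ * g x) ∂(π.tilted fun x => lam * g x) :=
    convexOn_exp.map_integral_le Real.continuous_exp.continuousOn isClosed_univ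
      (Filter.Eventually.of_forall fun x => Set.mem_univ _)
      (Integrable.of_bound (hg.const_mul θ).aestronglyMeasurable _
        (Filter.Eventually.of_forall (hmul θ)))
      (integrable_exp_of_abs_le _ (hg.const_mul θ) (hmul θ))
  refine h1.trans (le_of_eq ?_)
  rw [integral_exp_tilted, div_eq_mul_inv]
  congr 2
  ext x
  simp only [Pi.add_apply]
  ring_nf

theorem ofReal_exp_mul_integral_tilted_le {α : Type*} [MeasurableSpace α] (π : Measure α)
    [IsProbabilityMeasure π] {g : α → ℝ} (hg : Measurable g) {C : ℝ} (hC : ∀ x, |g x| ≤ C)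
    (lam θ : ℝ) {B : Set α} (hB : π B ≠ 0) :
    ENNReal.ofReal (Real.exp (θ * ∫ x, g x ∂(π.tilted fun x => lam * g x))) ≤
      (∫⁻ x, ∫⁻ y in B, ENNReal.ofReal (Real.exp ((lam + θ) * g x - lam * g y)) ∂π ∂π)
        / π B ^ 2 := by
  have hmul : ∀ a : ℝ, ∀ x, |a * g x| ≤ |a| * C := fun a x => by
    rw [abs_mul]; exact mul_le_mul_of_nonneg_left (hC x) (abs_nonneg _)
  have hV : 0 < π.real B := ENNReal.toReal_pos hB (measure_ne_top _ _)
  have h1 := (exp_mul_integral_tilted_le π hg hC lam θ).trans (mul_le_mul_of_nonneg_left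
    (inv_integral_exp_le π (hg.const_mul lam) (hmul lam) hB)
    (integral_nonneg fun x => (Real.exp_pos _).le))
  have hneg : Integrable (fun x => Real.exp (-(lam * g x))) (π.restrict B) :=
    integrable_exp_of_abs_le _ (hg.const_mul lam).neg (C := |lam| * C) fun x => by
      simpa using hmul lam x
  refine (ENNReal.ofReal_le_ofReal h1).trans (le_of_eq ?_)
  rw [← mul_div_assoc, ENNReal.ofReal_div_of_pos (by positivity),
    ENNReal.ofReal_pow measureReal_nonneg, ofReal_measureReal]
  congr 1
  simp_rw [sub_eq_add_neg, Real.exp_add, ENNReal.ofReal_mul (Real.exp_pos _).le]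
  rw [ENNReal.ofReal_mul (integral_nonneg fun x => (Real.exp_pos _).le),
    ofReal_integral_eq_lintegral_ofReal
      (integrable_exp_of_abs_le π (hg.const_mul _) (hmul (lam + θ)))
      (Filter.Eventually.of_forall fun x => (Real.exp_pos _).le),
    ofReal_integral_eq_lintegral_ofReal hneg
      (Filter.Eventually.of_forall fun x => (Real.exp_pos _).le)]
  have hm : ∀ a : ℝ, Measurable fun x => ENNReal.ofReal (Real.exp (a * g x)) := fun a =>
    (hg.const_mul a).exp.ennreal_ofReal
  rw [← lintegral_mul_const _ (hm _)]
  refine lintegral_congr fun x => ?_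
  rw [← lintegral_const_mul _ (by fun_prop)]

/-! ### Laplace integrals under a doubling condition. -/

/-- The exponents of successive doublings form a geometric sum, so the accumulated cost stays linear
in the final radius. -/
theorem measure_le_pow_two_mul {α : Type*} [MeasurableSpace α] (π : Measure α) (D : α → ℝ)
    {r δ : ℝ} (hr : 0 < r) (hδ : 0 ≤ δ)
    (hdbl : ∀ r', r ≤ r' →
      π {x | D x ≤ 2 * r'} ≤ ENNReal.ofReal (Real.exp (δ * r')) * π {x | D x ≤ r'}) (k : ℕ) :
    π {x | D x ≤ 2 ^ k * r} ≤
      ENNReal.ofReal (Real.exp (δ * (2 ^ k * r))) * π {x | D x ≤ r} := by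
  induction k with
  | zero =>
    simp only [pow_zero, one_mul]
    refine le_mul_of_one_le_left zero_le ?_
    rw [ENNReal.one_le_ofReal]
    exact Real.one_le_exp (by positivity)
  | succ k ih =>
    have h1 := hdbl (2 ^ k * r) (le_mul_of_one_le_left hr.le (one_le_pow₀ (by norm_num)))
    have e : (2 : ℝ) ^ (k + 1) * r = 2 * (2 ^ k * r) := by ring
    rw [e]
    refine h1.trans ((mul_le_mul_right ih _).trans (le_of_eq ?_))
    rw [← mul_assoc, ← ENNReal.ofReal_mul (Real.exp_pos _).le, ← Real.exp_add]
    congr 3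
    ring

/-- Since 2^k ≥ k + 1, a geometric series dominates, with sum 1/(exp y − 1) ≤ 1/y. -/
theorem tsum_ofReal_exp_neg_mul_two_pow_le {y : ℝ} (hy : 0 < y) :
    ∑' k : ℕ, ENNReal.ofReal (Real.exp (-(y * 2 ^ k))) ≤ ENNReal.ofReal (1 / y) := by
  have hlt : Real.exp (-y) < 1 := Real.exp_lt_one_iff.mpr (by linarith)
  have h0 := Real.exp_pos (-y)
  have h1 : ∀ k : ℕ, ENNReal.ofReal (Real.exp (-(y * 2 ^ k))) ≤
      ENNReal.ofReal (Real.exp (-y) * Real.exp (-y) ^ k) := by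
    intro k
    refine ENNReal.ofReal_le_ofReal ?_
    rw [← pow_succ', ← Real.exp_nat_mul, Real.exp_le_exp]
    have : ((k + 1 : ℕ) : ℝ) ≤ 2 ^ k := by exact_mod_cast Nat.lt_two_pow_self
    nlinarith
  refine (ENNReal.tsum_le_tsum h1).trans ?_
  rw [← ENNReal.ofReal_tsum_of_nonneg (fun k => by positivity)
    ((summable_geometric_of_lt_one h0.le hlt).mul_left _), tsum_mul_left,
    tsum_geometric_of_lt_one h0.le hlt]
  refine ENNReal.ofReal_le_ofReal ?_
  rw [← div_eq_mul_inv, div_le_div_iff₀ (by linarith) hy]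
  have h2 := Real.add_one_le_exp y
  have h3 : Real.exp (-y) * Real.exp y = 1 := by rw [← Real.exp_add]; simp
  nlinarith

/-- Dyadic shells: on 2^k r ≤ D < 2^(k+1) r the integrand is at most exp(−κ2^k r), while the mass
has grown by at most exp(2δ2^k r). Hence the requirement `2 * δ < κ`. -/
theorem lintegral_exp_neg_le_of_doubling {α : Type*} [MeasurableSpace α] (π : Measure α)
    {D : α → ℝ} (hD : Measurable D) (hD0 : ∀ x, 0 ≤ D x) {r δ κ : ℝ} (hr : 0 < r) (hδ : 0 ≤ δ)
    (hκ : 2 * δ < κ)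
    (hdbl : ∀ r', r ≤ r' →
      π {x | D x ≤ 2 * r'} ≤ ENNReal.ofReal (Real.exp (δ * r')) * π {x | D x ≤ r'}) :
    ∫⁻ x, ENNReal.ofReal (Real.exp (-(κ * D x))) ∂π ≤
      π {x | D x ≤ r} * ENNReal.ofReal (1 + 1 / ((κ - 2 * δ) * r)) := by
  have hms : ∀ a : ℝ, MeasurableSet {x | D x ≤ a} := fun a => measurableSet_le hD measurable_const
  have hκ0 : 0 ≤ κ := by linarith
  have hy : 0 < (κ - 2 * δ) * r := mul_pos (by linarith) hr
  have hpt : ∀ x, ENNReal.ofReal (Real.exp (-(κ * D x))) ≤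
      {x | D x ≤ r}.indicator (fun _ => 1) x + ∑' k : ℕ, {x | D x ≤ 2 ^ (k + 1) * r}.indicator
        (fun _ => ENNReal.ofReal (Real.exp (-(κ * (2 ^ k * r))))) x := by
    intro x
    by_cases hx : D x ≤ r
    · refine le_trans ?_ le_self_add
      rw [Set.indicator_of_mem (by exact hx), ENNReal.ofReal_le_one]
      exact Real.exp_le_one_iff.mpr (by have := mul_nonneg hκ0 (hD0 x); linarith)
    · push Not at hx
      obtain ⟨k, hk1, hk2⟩ := exists_nat_pow_near ((one_le_div hr).mpr hx.le) one_lt_two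
      rw [le_div_iff₀ hr] at hk1
      rw [div_lt_iff₀ hr] at hk2
      refine le_trans ?_ le_add_self
      refine le_trans ?_ (ENNReal.le_tsum k)
      rw [Set.indicator_of_mem (by exact hk2.le)]
      refine ENNReal.ofReal_le_ofReal (Real.exp_le_exp.mpr ?_)
      have := mul_le_mul_of_nonneg_left hk1 hκ0
      linarith
  refine (lintegral_mono hpt).trans ?_
  rw [lintegral_add_left (measurable_const.indicator (hms r)),
    lintegral_tsum fun k => (measurable_const.indicator (hms _)).aemeasurable]
  simp_rw [lintegral_indicator_const (hms _)]
  rw [ENNReal.ofReal_add zero_le_one (by positivity), mul_add, one_mul, ENNReal.ofReal_one, mul_one]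
  gcongr
  refine le_trans ?_ (mul_le_mul_right (tsum_ofReal_exp_neg_mul_two_pow_le hy) _)
  rw [← ENNReal.tsum_mul_left]
  refine ENNReal.tsum_le_tsum fun k => ?_
  refine (mul_le_mul_right (measure_le_pow_two_mul π D hr hδ hdbl (k + 1)) _).trans (le_of_eq ?_)
  rw [← mul_assoc, ← ENNReal.ofReal_mul (Real.exp_pos _).le, ← Real.exp_add, mul_comm]
  congr 3
  ring

/-! ### Bounding the posterior by triple integrals. -/

theorem abs_testSum_le {E 𝓜 : Type*} {t : 𝓜 → 𝓜 → E → ℝ} {n : ℕ}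
    (hb : ∀ P Q x, |t P Q x| ≤ 1 / 2) (x : Fin n → E) (P Q : 𝓜) :
    |testSum t x P Q| ≤ n := by
  unfold testSum
  refine (Finset.abs_sum_le_sum_abs _ _).trans ?_
  refine (Finset.sum_le_sum fun i _ => (hb P Q (x i)).trans (by norm_num : (1 : ℝ) / 2 ≤ 1)).trans ?_
  simp

theorem lintegral_prod_prod {α β γ : Type*} [MeasurableSpace α] [MeasurableSpace β]
    [MeasurableSpace γ] {f : α × β × γ → ℝ≥0∞} (hf : Measurable f) (μ : Measure α) (ν : Measure β)
    (ρ : Measure γ) [SFinite ν] [SFinite ρ] :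
    ∫⁻ z, f z ∂(μ.prod (ν.prod ρ)) = ∫⁻ a, ∫⁻ b, ∫⁻ c, f (a, b, c) ∂ρ ∂ν ∂μ := by
  rw [lintegral_prod _ hf.aemeasurable]
  exact lintegral_congr fun a => lintegral_prod _ (hf.comp measurable_prodMk_left).aemeasurable

section Tests

variable {E 𝓜 : Type*} [MeasurableSpace E] [MeasurableSpace 𝓜] {t : 𝓜 → 𝓜 → E → ℝ} {n : ℕ}

theorem measurable_testSum (ht : Measurable fun z : E × 𝓜 × 𝓜 => t z.2.1 z.2.2 z.1) :
    Measurable fun z : (Fin n → E) × 𝓜 × 𝓜 => testSum t z.1 z.2.1 z.2.2 := by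
  unfold testSum
  refine Finset.measurable_sum _ fun i _ => ?_
  exact ht.comp (f := fun z : (Fin n → E) × 𝓜 × 𝓜 => (z.1 i, z.2)) (by fun_prop)

theorem measurable_testSum_right (ht : Measurable fun z : E × 𝓜 × 𝓜 => t z.2.1 z.2.2 z.1)
    (x : Fin n → E) (P : 𝓜) : Measurable fun Q => testSum t x P Q :=
  (measurable_testSum ht).comp (measurable_prodMk_left.comp measurable_prodMk_left)

theorem measurable_meanTest (ht : Measurable fun z : E × 𝓜 × 𝓜 => t z.2.1 z.2.2 z.1)
    (lam : ℝ) (π : Measure 𝓜) [SFinite π] (x : Fin n → E) :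
    Measurable fun P => meanTest t lam π x P := by
  have hT : Measurable fun z : 𝓜 × 𝓜 => testSum t x z.1 z.2 :=
    (measurable_testSum ht).comp measurable_prodMk_left
  have hZ : Measurable fun P => ∫ Q, Real.exp (lam * testSum t x P Q) ∂π :=
    ((hT.const_mul lam).exp.stronglyMeasurable.integral_prod_right).measurable
  simp only [meanTest, innerPosterior, integral_tilted]
  have hF : Measurable fun z : 𝓜 × 𝓜 => (Real.exp (lam * testSum t x z.1 z.2) /
      ∫ Q, Real.exp (lam * testSum t x z.1 Q) ∂π) • testSum t x z.1 z.2 :=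
    ((hT.const_mul lam).exp.div (hZ.comp measurable_fst)).smul hT
  exact hF.stronglyMeasurable.integral_prod_right.measurable

theorem isProbabilityMeasure_innerPosterior
    (ht : Measurable fun z : E × 𝓜 × 𝓜 => t z.2.1 z.2.2 z.1) (hb : ∀ P Q x, |t P Q x| ≤ 1 / 2)
    (lam : ℝ) (π : Measure 𝓜) [IsProbabilityMeasure π] (x : Fin n → E) (P : 𝓜) :
    IsProbabilityMeasure (innerPosterior t lam π x P) :=
  isProbabilityMeasure_tilted (integrable_exp_of_abs_le π (C := |lam| * n)
    ((measurable_testSum_right ht x P).const_mul lam) fun Q => by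
      rw [abs_mul]; exact mul_le_mul_of_nonneg_left (abs_testSum_le hb x P Q) (abs_nonneg _))

theorem abs_meanTest_le (ht : Measurable fun z : E × 𝓜 × 𝓜 => t z.2.1 z.2.2 z.1)
    (hb : ∀ P Q x, |t P Q x| ≤ 1 / 2) (lam : ℝ) (π : Measure 𝓜) [IsProbabilityMeasure π]
    (x : Fin n → E) (P : 𝓜) : |meanTest t lam π x P| ≤ n := by
  have := isProbabilityMeasure_innerPosterior ht hb lam π x P
  have h := norm_integral_le_of_norm_le_const (μ := innerPosterior t lam π x P)
    (f := fun Q => testSum t x P Q) (Filter.Eventually.of_forall fun Q => abs_testSum_le hb x P Q)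
  simpa [meanTest] using h

theorem abs_mul_meanTest_le (ht : Measurable fun z : E × 𝓜 × 𝓜 => t z.2.1 z.2.2 z.1)
    (hb : ∀ P Q x, |t P Q x| ≤ 1 / 2) (a lam : ℝ) (π : Measure 𝓜) [IsProbabilityMeasure π]
    (x : Fin n → E) (P : 𝓜) : |a * meanTest t lam π x P| ≤ |a| * n := by
  rw [abs_mul]
  exact mul_le_mul_of_nonneg_left (abs_meanTest_le ht hb lam π x P) (abs_nonneg _)

theorem isProbabilityMeasure_posterior
    (ht : Measurable fun z : E × 𝓜 × 𝓜 => t z.2.1 z.2.2 z.1) (hb : ∀ P Q x, |t P Q x| ≤ 1 / 2)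
    (β c : ℝ) (π : Measure 𝓜) [IsProbabilityMeasure π] (x : Fin n → E) :
    IsProbabilityMeasure (posterior t β c π x) :=
  isProbabilityMeasure_tilted (integrable_exp_of_abs_le π
    ((measurable_meanTest ht _ π x).const_mul _) (abs_mul_meanTest_le ht hb _ _ π x))

theorem posterior_le (ht : Measurable fun z : E × 𝓜 × 𝓜 => t z.2.1 z.2.2 z.1)
    (hb : ∀ P Q x, |t P Q x| ≤ 1 / 2) (β c : ℝ) (π : Measure 𝓜) [IsProbabilityMeasure π]
    (x : Fin n → E) {A B : Set 𝓜} (hA : MeasurableSet A) (hB : π B ≠ 0) :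
    posterior t β c π x A ≤
      (∫⁻ P in A, ENNReal.ofReal (Real.exp (-β * meanTest t ((1 + c) * β) π x P)) ∂π) *
      ((∫⁻ P in B, ENNReal.ofReal (Real.exp (β * meanTest t ((1 + c) * β) π x P)) ∂π)
        / π B ^ 2) := by
  have hm := measurable_meanTest ht ((1 + c) * β) π x
  have hV : 0 < π.real B := ENNReal.toReal_pos hB (measure_ne_top _ _)
  have hinv := inv_integral_exp_le π (hm.const_mul (-β))
    (abs_mul_meanTest_le ht hb (-β) ((1 + c) * β) π x) hB
  simp only [neg_mul, neg_neg] at hinv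
  have hinv' := ENNReal.ofReal_le_ofReal hinv
  rw [ENNReal.ofReal_div_of_pos (by positivity), ENNReal.ofReal_pow measureReal_nonneg,
    ofReal_measureReal, ofReal_integral_eq_lintegral_ofReal
      (integrable_exp_of_abs_le _ (hm.const_mul β)
        (abs_mul_meanTest_le ht hb β ((1 + c) * β) π x))
      (Filter.Eventually.of_forall fun x => (Real.exp_pos _).le)] at hinv'
  refine le_trans ?_ (mul_le_mul_right hinv' _)
  rw [posterior, tilted_apply' _ _ hA, ← lintegral_mul_const _ (by fun_prop)]
  refine le_of_eq (lintegral_congr fun P => ?_)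
  rw [div_eq_mul_inv, ENNReal.ofReal_mul (Real.exp_pos _).le]
  simp only [neg_mul]

/-- The integral of `exp (u * T(x, P, Q') - v * T(x, P, Q))` over `P ∈ A`, `Q'` and `Q ∈ B`. -/
def tripleIntegral (t : 𝓜 → 𝓜 → E → ℝ) (π : Measure 𝓜) (A B : Set 𝓜) (u v : ℝ)
    (x : Fin n → E) : ℝ≥0∞ :=
  ∫⁻ z : 𝓜 × 𝓜 × 𝓜, ENNReal.ofReal
    (Real.exp (u * testSum t x z.1 z.2.1 - v * testSum t x z.1 z.2.2))
    ∂((π.restrict A).prod (π.prod (π.restrict B)))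

theorem measurable_tripleIntegrand (ht : Measurable fun z : E × 𝓜 × 𝓜 => t z.2.1 z.2.2 z.1)
    (u v : ℝ) :
    Measurable fun w : (Fin n → E) × 𝓜 × 𝓜 × 𝓜 => ENNReal.ofReal
      (Real.exp (u * testSum t w.1 w.2.1 w.2.2.1 - v * testSum t w.1 w.2.1 w.2.2.2)) := by
  have hT := measurable_testSum (n := n) ht
  have h1 : Measurable fun w : (Fin n → E) × 𝓜 × 𝓜 × 𝓜 => testSum t w.1 w.2.1 w.2.2.1 :=
    hT.comp (f := fun w : (Fin n → E) × 𝓜 × 𝓜 × 𝓜 => (w.1, w.2.1, w.2.2.1)) (by fun_prop)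
  have h2 : Measurable fun w : (Fin n → E) × 𝓜 × 𝓜 × 𝓜 => testSum t w.1 w.2.1 w.2.2.2 :=
    hT.comp (f := fun w : (Fin n → E) × 𝓜 × 𝓜 × 𝓜 => (w.1, w.2.1, w.2.2.2)) (by fun_prop)
  exact ((h1.const_mul u).sub (h2.const_mul v)).exp.ennreal_ofReal

theorem measurable_tripleIntegral (ht : Measurable fun z : E × 𝓜 × 𝓜 => t z.2.1 z.2.2 z.1)
    (π : Measure 𝓜) [IsProbabilityMeasure π] (A B : Set 𝓜) (u v : ℝ) :
    Measurable (tripleIntegral (n := n) t π A B u v) :=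
  (measurable_tripleIntegrand ht u v).lintegral_prod_right'

theorem tripleIntegral_eq (ht : Measurable fun z : E × 𝓜 × 𝓜 => t z.2.1 z.2.2 z.1)
    (π : Measure 𝓜) [IsProbabilityMeasure π] (A B : Set 𝓜) (u v : ℝ) (x : Fin n → E) :
    tripleIntegral t π A B u v x = ∫⁻ P in A, ∫⁻ Q', ∫⁻ Q in B, ENNReal.ofReal
      (Real.exp (u * testSum t x P Q' - v * testSum t x P Q)) ∂π ∂π ∂π :=
  lintegral_prod_prod (measurable_tripleIntegrand ht u v |>.comp
    (measurable_prodMk_left (x := x))) _ _ _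

theorem setLIntegral_exp_mul_meanTest_le
    (ht : Measurable fun z : E × 𝓜 × 𝓜 => t z.2.1 z.2.2 z.1) (hb : ∀ P Q x, |t P Q x| ≤ 1 / 2)
    (lam θ : ℝ) (π : Measure 𝓜) [IsProbabilityMeasure π] (x : Fin n → E) (A : Set 𝓜) {B : Set 𝓜}
    (hB : π B ≠ 0) :
    ∫⁻ P in A, ENNReal.ofReal (Real.exp (θ * meanTest t lam π x P)) ∂π ≤
      tripleIntegral t π A B (lam + θ) lam x / π B ^ 2 := by
  rw [tripleIntegral_eq ht, div_eq_mul_inv,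
    ← lintegral_mul_const' _ _ (ENNReal.inv_ne_top.mpr (pow_ne_zero 2 hB))]
  refine lintegral_mono fun P => ?_
  rw [← div_eq_mul_inv]
  exact ofReal_exp_mul_integral_tilted_le π (measurable_testSum_right ht x P)
    (abs_testSum_le hb x P) lam θ hB

theorem lintegral_tripleIntegral_le (ht : Measurable fun z : E × 𝓜 × 𝓜 => t z.2.1 z.2.2 z.1)
    (π : Measure 𝓜) [IsProbabilityMeasure π] {A B : Set 𝓜} (hA : MeasurableSet A)
    (hB : MeasurableSet B) {u v : ℝ} (ν : Measure (Fin n → E)) [SFinite ν] {F G : 𝓜 → ℝ≥0∞}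
    (hF : Measurable F) (hG : Measurable G) (a : ℝ≥0∞)
    (hle : ∀ P ∈ A, ∀ Q', ∀ Q ∈ B, ∫⁻ x, ENNReal.ofReal
      (Real.exp (u * testSum t x P Q' - v * testSum t x P Q)) ∂ν ≤ F P * (G Q' * a)) :
    ∫⁻ x, tripleIntegral t π A B u v x ∂ν ≤
      (∫⁻ P in A, F P ∂π) * ((∫⁻ Q', G Q' ∂π) * (a * π B)) := by
  have hm := measurable_tripleIntegrand (n := n) ht u v
  unfold tripleIntegral
  rw [lintegral_lintegral_swap hm.aemeasurable, lintegral_prod_prod hm.lintegral_prod_left',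
    ← lintegral_mul_const _ hF]
  refine setLIntegral_mono' hA fun P hP => ?_
  rw [← lintegral_mul_const _ hG, ← lintegral_const_mul _ (hG.mul_const _)]
  refine lintegral_mono fun Q' => ?_
  refine (setLIntegral_mono' hB fun Q hQ => hle P hP Q' Q hQ).trans (le_of_eq ?_)
  rw [setLIntegral_const]
  ring

theorem meas_ge_exp_mul_le {α : Type*} [MeasurableSpace α] {ν : Measure α} {f : α → ℝ≥0∞}
    (hf : Measurable f) {b y : ℝ} (hb : 0 < b) (h : ∫⁻ x, f x ∂ν ≤ ENNReal.ofReal b) :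
    ν {x | ENNReal.ofReal (Real.exp y * b) ≤ f x} ≤ ENNReal.ofReal (Real.exp (-y)) := by
  have h1 := (mul_meas_ge_le_lintegral (μ := ν) hf (ENNReal.ofReal (Real.exp y * b))).trans h
  have hpos : 0 < Real.exp y * b := by positivity
  rw [mul_comm, ← ENNReal.le_div_iff_mul_le (Or.inl (by simpa using hpos))
    (Or.inl ENNReal.ofReal_ne_top), ← ENNReal.ofReal_div_of_pos hpos] at h1
  refine h1.trans (le_of_eq ?_)
  congr 1
  rw [Real.exp_neg]
  field_simp

/-- Each triple integral is of order π(B)^3 in expectation. The product π(B)^6 cancels the three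
squares in the denominator: one from the outer normalisation and one from each inner one. Markov at
level exp(ξ/2) for each factor costs ξ in the exponent. -/
theorem exists_posterior_le (ht : Measurable fun z : E × 𝓜 × 𝓜 => t z.2.1 z.2.2 z.1)
    (hb : ∀ P Q x, |t P Q x| ≤ 1 / 2) (β c : ℝ) (π : Measure 𝓜) [IsProbabilityMeasure π]
    {A B : Set 𝓜} (hA : MeasurableSet A) (hB : π B ≠ 0) (ν : Measure (Fin n → E))
    {c₁ c₂ ξ : ℝ}
    (h1 : ∫⁻ x, tripleIntegral t π A B (c * β) ((1 + c) * β) x ∂ν ≤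
      ENNReal.ofReal (π.real B ^ 3 * Real.exp c₁))
    (h2 : ∫⁻ x, tripleIntegral t π B B ((2 + c) * β) ((1 + c) * β) x ∂ν ≤
      ENNReal.ofReal (π.real B ^ 3 * Real.exp c₂))
    (hc : c₁ + c₂ + ξ ≤ -ξ / 2) :
    ∃ N, MeasurableSet N ∧ ν N ≤ ENNReal.ofReal (2 * Real.exp (-ξ / 2)) ∧
      ∀ x ∉ N, posterior t β c π x A ≤ ENNReal.ofReal (Real.exp (-ξ / 2)) := by
  have hV : 0 < π.real B := ENNReal.toReal_pos hB (measure_ne_top _ _)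
  have hm1 := measurable_tripleIntegral (n := n) ht π A B (c * β) ((1 + c) * β)
  have hm2 := measurable_tripleIntegral (n := n) ht π B B ((2 + c) * β) ((1 + c) * β)
  refine ⟨{x | ENNReal.ofReal (Real.exp (ξ / 2) * (π.real B ^ 3 * Real.exp c₁)) ≤
      tripleIntegral t π A B (c * β) ((1 + c) * β) x} ∪
    {x | ENNReal.ofReal (Real.exp (ξ / 2) * (π.real B ^ 3 * Real.exp c₂)) ≤
      tripleIntegral t π B B ((2 + c) * β) ((1 + c) * β) x},
    (measurableSet_le measurable_const hm1).union (measurableSet_le measurable_const hm2), ?_, ?_⟩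
  · refine (measure_union_le _ _).trans ((add_le_add (meas_ge_exp_mul_le hm1 (by positivity) h1)
      (meas_ge_exp_mul_le hm2 (by positivity) h2)).trans (le_of_eq ?_))
    rw [← ENNReal.ofReal_add (Real.exp_pos _).le (Real.exp_pos _).le, ← two_mul, neg_div]
  · intro x hx
    simp only [Set.mem_union, Set.mem_ofPred_eq, not_or, not_le] at hx
    have hle := posterior_le ht hb β c π x hA hB
    have e1 := setLIntegral_exp_mul_meanTest_le ht hb ((1 + c) * β) (-β) π x A hB
    have e2 := setLIntegral_exp_mul_meanTest_le ht hb ((1 + c) * β) β π x B hB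
    rw [show (1 + c) * β + -β = c * β by ring] at e1
    rw [show (1 + c) * β + β = (2 + c) * β by ring] at e2
    have e1' := e1.trans (ENNReal.div_le_div_right hx.1.le _)
    have e2' := ENNReal.div_le_div_right (e2.trans (ENNReal.div_le_div_right hx.2.le _)) (π B ^ 2)
    have hVof : π B ^ 2 = ENNReal.ofReal (π.real B ^ 2) := by
      rw [ENNReal.ofReal_pow measureReal_nonneg, ofReal_measureReal]
    rw [hVof, ← ENNReal.ofReal_div_of_pos (by positivity)] at e1' e2'
    rw [← ENNReal.ofReal_div_of_pos (by positivity)] at e2'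
    rw [hVof] at hle
    refine hle.trans ((mul_le_mul' e1' e2').trans ?_)
    rw [← ENNReal.ofReal_mul (by positivity)]
    refine ENNReal.ofReal_le_ofReal ?_
    have e3 : Real.exp (ξ / 2) * (π.real B ^ 3 * Real.exp c₁) / π.real B ^ 2 *
        (Real.exp (ξ / 2) * (π.real B ^ 3 * Real.exp c₂) / π.real B ^ 2 / π.real B ^ 2) =
        Real.exp (c₁ + c₂ + ξ) := by
      rw [show c₁ + c₂ + ξ = ξ / 2 + c₁ + (ξ / 2 + c₂) by ring, Real.exp_add, Real.exp_add,
        Real.exp_add]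
      field_simp
    rw [e3]
    exact Real.exp_le_exp.mpr hc

end Tests

/-! ### Prior masses and the radius. -/

section Prior

variable {E 𝓜 : Type*} [MeasurableSpace E] [MeasurableSpace 𝓜]

theorem measure_ball_le_of_priorRatio_le (law : 𝓜 → Measure E) (π : Measure 𝓜) [IsFiniteMeasure π] (P : 𝓜)
    (r a : ℝ) (h : priorRatio law π P r ≤ ENNReal.ofReal a) :
    π (hellingerBall law (law P) r) ≠ 0 ∧ π (hellingerBall law (law P) (2 * r)) ≤
      ENNReal.ofReal a * π (hellingerBall law (law P) r) := by
  unfold priorRatio at h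
  split_ifs at h with h0
  · exact absurd h (not_le.mpr ENNReal.ofReal_lt_top)
  · exact ⟨h0, (ENNReal.div_le_iff h0 (measure_ne_top _ _)).mp h⟩

/-- Used with y = nr/62500, where r ≥ 8000/(3n) gives y ≥ 16/375. Then the left side is at most 644
< exp 8, and 200y ≥ 8. -/
theorem one_add_inv_le_exp {y : ℝ} (hy : 16 / 375 ≤ y) :
    1 + 1 / (7 / 192 * y) ≤ Real.exp (200 * y) := by
  have h1 : 1 / (7 / 192 * y) ≤ 643 := by
    rw [div_le_iff₀ (by linarith)]
    linarith
  have h2 : (644 : ℝ) ≤ Real.exp 8 := by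
    have h3 : (2.7 : ℝ) ^ 8 ≤ Real.exp 1 ^ 8 :=
      pow_le_pow_left₀ (by norm_num) (by linarith [Real.exp_one_gt_d9]) 8
    rw [← Real.exp_nat_mul] at h3
    norm_num at h3
    linarith
  have h3 : Real.exp 8 ≤ Real.exp (200 * y) := Real.exp_le_exp.mpr (by linarith)
  linarith

theorem lintegral_exp_neg_hellingerSq_le (law : 𝓜 → Measure E) [∀ P, IsProbabilityMeasure (law P)]
    (π : Measure 𝓜) [IsProbabilityMeasure π] (S : Measure E) [IsProbabilityMeasure S]
    (hloss : ∀ S : Measure E, IsProbabilityMeasure S → Measurable fun P => hellingerSq S (law P))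
    {n : ℕ} (hn : 0 < n) (P₀ : 𝓜) {r : ℝ} (hr : 8000 / (3 * (n : ℝ)) ≤ r)
    (hratio : ∀ r' : ℝ, r ≤ r' → priorRatio law π P₀ r' ≤
      ENNReal.ofReal (Real.exp (3 * (n : ℝ) * r' / (8 * 10 ^ 6)))) :
    ∫⁻ P, ENNReal.ofReal (Real.exp (-((n : ℝ) / 62500 / 6 * hellingerSq S (law P)))) ∂π ≤
      ENNReal.ofReal (π.real (hellingerBall law (law P₀) r) *
        Real.exp ((n : ℝ) / 62500 * (hellingerSq S (law P₀) / 6 + 200 * r))) := by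
  have hn' : (0 : ℝ) < n := by exact_mod_cast hn
  have hr0 : 0 < r := lt_of_lt_of_le (by positivity) hr
  have hnr : 16 / 375 ≤ (n : ℝ) / 62500 * r := by
    rw [div_le_iff₀ (by positivity)] at hr
    linarith
  obtain ⟨m, hm⟩ : ∃ m, m = (n : ℝ) / 62500 := ⟨_, rfl⟩
  have hm0 : 0 < m := by rw [hm]; positivity
  rw [← hm] at hnr ⊢
  -- Recentring from `S` to `law P₀` halves the rate m/6 to m/12. The prior exponent 3n/(8·10⁶)
  -- equals 3m/128, leaving the gap m(1/12 − 3/64) = 7m/192.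
  have hJ := lintegral_exp_neg_le_of_doubling π (hloss (law P₀) inferInstance)
    (fun P => hellingerSq_nonneg _ _) (r := r) (δ := m * (3 / 128)) (κ := m / 12) hr0
    (by positivity) (by linarith) (fun r' hr' => by
      have h := (measure_ball_le_of_priorRatio_le law π P₀ r' _ (hratio r' hr')).2
      have e : 3 * (n : ℝ) * r' / (8 * 10 ^ 6) = m * (3 / 128) * r' := by rw [hm]; ring
      rwa [e] at h)
  have e1 : (m / 12 - 2 * (m * (3 / 128))) * r = 7 / 192 * (m * r) := by ring
  rw [e1] at hJ
  have hpt : ∀ P, ENNReal.ofReal (Real.exp (-(m / 6 * hellingerSq S (law P)))) ≤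
      ENNReal.ofReal (Real.exp (m * (hellingerSq S (law P₀) / 6))) *
      ENNReal.ofReal (Real.exp (-(m / 12 * hellingerSq (law P₀) (law P)))) := by
    intro P
    rw [← ENNReal.ofReal_mul (Real.exp_pos _).le, ← Real.exp_add]
    refine ENNReal.ofReal_le_ofReal (Real.exp_le_exp.mpr ?_)
    have h1 := hellingerSq_le_two_mul_add (law P₀) S (law P)
    rw [hellingerSq_comm (law P₀) S] at h1
    have h2 := mul_le_mul_of_nonneg_left h1 hm0.le
    linarith
  refine (lintegral_mono hpt).trans ?_
  rw [lintegral_const_mul' _ _ ENNReal.ofReal_ne_top]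
  refine (mul_le_mul_right hJ _).trans ?_
  rw [mul_add m, Real.exp_add, ENNReal.ofReal_mul measureReal_nonneg, ofReal_measureReal,
    ENNReal.ofReal_mul (Real.exp_pos _).le, mul_left_comm]
  refine mul_le_mul_right (mul_le_mul_right (ENNReal.ofReal_le_ofReal ?_) _) _
  have := one_add_inv_le_exp hnr
  rwa [show m * (200 * r) = 200 * (m * r) by ring]

/-- Neither the infimum over `P` nor the one defining the radius need be attained. The total is
positive because radii are at least 8000/(3n), so doubling it leaves room to choose both. -/
theorem exists_radius_lt (law : 𝓜 → Measure E) (π : Measure 𝓜) (S : Measure E) {n : ℕ}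
    (hn : 0 < n)
    (hW : (⨅ P : 𝓜, (ENNReal.ofReal (hellingerSq S (law P)) + hellingerRadius law π n P)) ≠ ⊤) :
    ∃ (P₀ : 𝓜) (r : ℝ), 8000 / (3 * (n : ℝ)) ≤ r ∧
      (∀ r' : ℝ, r ≤ r' → priorRatio law π P₀ r' ≤
        ENNReal.ofReal (Real.exp (3 * (n : ℝ) * r' / (8 * 10 ^ 6)))) ∧
      ENNReal.ofReal (hellingerSq S (law P₀)) + ENNReal.ofReal r <
        2 * ⨅ P : 𝓜, (ENNReal.ofReal (hellingerSq S (law P)) + hellingerRadius law π n P) := by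
  set W := ⨅ P : 𝓜, (ENNReal.ofReal (hellingerSq S (law P)) + hellingerRadius law π n P) with hWdef
  have hn' : (0 : ℝ) < n := by exact_mod_cast hn
  have hpos : 0 < W := by
    refine lt_of_lt_of_le (b := ENNReal.ofReal (8000 / (3 * (n : ℝ)))) ?_ ?_
    · rw [ENNReal.ofReal_pos]; positivity
    · refine le_iInf fun P => le_trans ?_ le_add_self
      refine le_sInf ?_
      rintro _ ⟨r, hr, rfl⟩
      exact ENNReal.ofReal_le_ofReal hr.1
  have hlt : W < 2 * W := by
    rw [two_mul]
    exact ENNReal.lt_add_right hW hpos.ne'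
  obtain ⟨P₀, hP₀⟩ := iInf_lt_iff.mp (hWdef ▸ hlt)
  by_contra hcon
  push Not at hcon
  refine absurd hP₀ (not_lt.mpr ?_)
  rw [← tsub_le_iff_left]
  refine le_sInf ?_
  rintro _ ⟨r, hr, rfl⟩
  rw [tsub_le_iff_left]
  exact hcon P₀ r hr.1 hr.2

end Prior

/-! ### Choice of constants and conclusion. -/

theorem exists_posterior_far_le {E : Type*} [MeasurableSpace E] {n : ℕ} (hn : 0 < n)
    (Pstar : Fin n → Measure E) [∀ i, IsProbabilityMeasure (Pstar i)] {𝓜 : Type*}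
    [MeasurableSpace 𝓜] (π : Measure 𝓜) [IsProbabilityMeasure π]
    (law : 𝓜 → Measure E) [∀ P, IsProbabilityMeasure (law P)]
    (μ : Measure E) (p : 𝓜 → E → ℝ≥0) (hp : ∀ P, Measurable (p P))
    (hlaw : ∀ P, law P = μ.withDensity fun x => (p P x : ℝ≥0∞))
    (hloss : ∀ S : Measure E, IsProbabilityMeasure S → Measurable fun P => hellingerSq S (law P))
    (htest : Measurable fun z : E × 𝓜 × 𝓜 => hellingerTest (p z.2.1) (p z.2.2) z.1)
    {ξ : ℝ} (hξ : 0 < ξ) (P₀ : 𝓜) {r : ℝ} (hr : 8000 / (3 * (n : ℝ)) ≤ r)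
    (hratio : ∀ r' : ℝ, r ≤ r' → priorRatio law π P₀ r' ≤
      ENNReal.ofReal (Real.exp (3 * (n : ℝ) * r' / (8 * 10 ^ 6)))) :
    ∃ N, MeasurableSet N ∧ Measure.pi Pstar N ≤ ENNReal.ofReal (2 * Real.exp (-ξ / 2)) ∧
      ∀ x ∉ N, posterior (fun P Q => hellingerTest (p P) (p Q)) (1 / 500) (1 / 125) π x
        {P | 847 * (hellingerSq (avgMeasure Pstar) (law P₀) + r) + 1694 * (5334 * ξ / n) <
          hellingerSq (avgMeasure Pstar) (law P)} ≤ ENNReal.ofReal (Real.exp (-ξ / 2)) := by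
  have hS := isProbabilityMeasure_avgMeasure hn Pstar
  have hJ := lintegral_exp_neg_hellingerSq_le law π (avgMeasure Pstar) hloss hn P₀ hr hratio
  have hmom := fun (u v : ℝ) (hu : 0 ≤ u) (hv : 0 ≤ v) (huv : u + v ≤ 2) =>
    lintegral_exp_testSum_sub_le hn Pstar law μ p hp hlaw hu hv huv
  set S := avgMeasure Pstar
  have hn' : (0 : ℝ) < n := by exact_mod_cast hn
  have hr0 : 0 < r := lt_of_lt_of_le (by positivity) hr
  obtain ⟨R, hR⟩ : ∃ R, R = 847 * (hellingerSq S (law P₀) + r) + 1694 * (5334 * ξ / n) := ⟨_, rfl⟩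
  rw [← hR]
  have hl0 := hellingerSq_nonneg S (law P₀)
  have hR0 : 0 ≤ R := by rw [hR]; positivity
  -- `m` is n·c·β. In this unit n(1 + c)β = 126m and n(2 + c)β = 251m.
  obtain ⟨m, hm⟩ : ∃ m, m = (n : ℝ) / 62500 := ⟨_, rfl⟩
  have hnm : (n : ℝ) = 62500 * m := by rw [hm]; ring
  have hm0 : 0 < m := by rw [hm]; positivity
  have hmξ : m * (5334 * ξ / n) = 5334 * ξ / 62500 := by
    rw [hm]; field_simp
  rw [← hm] at hJ
  set B := hellingerBall law (law P₀) r
  have hB0 : π B ≠ 0 := (measure_ball_le_of_priorRatio_le law π P₀ r _ (hratio r le_rfl)).1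
  have hBm : MeasurableSet B :=
    measurableSet_le (hloss (law P₀) inferInstance) measurable_const
  have hAm : MeasurableSet {P | R < hellingerSq S (law P)} :=
    measurableSet_lt measurable_const (hloss S hS)
  have hball : ∀ Q ∈ B, hellingerSq S (law Q) ≤ 2 * (hellingerSq S (law P₀) + r) := by
    intro Q hQ
    have h1 := hellingerSq_le_two_mul_add S (law P₀) (law Q)
    have h2 : hellingerSq (law P₀) (law Q) ≤ r := hQ
    linarith
  have hexpm : ∀ a b : ℝ, Measurable fun P =>
      ENNReal.ofReal (Real.exp (a + -(b * hellingerSq S (law P)))) := fun a b =>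
    (((hloss S hS).const_mul b).neg.const_add a).exp.ennreal_ofReal
  have hexpm0 : ∀ b : ℝ, Measurable fun P =>
      ENNReal.ofReal (Real.exp (-(b * hellingerSq S (law P)))) := fun b =>
    ((hloss S hS).const_mul b).neg.exp.ennreal_ofReal
  have hofB : ENNReal.ofReal (π.real B) = π B := ofReal_measureReal
  set l := hellingerSq S (law P₀)
  refine exists_posterior_le (t := fun P Q => hellingerTest (p P) (p Q)) htest
    (fun P Q x => abs_hellingerTest_le (p P) (p Q) x) (1 / 500) (1 / 125) π hAm hB0
    (Measure.pi Pstar)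
    (c₁ := -(20 * m * R) + m * (l / 6 + 200 * r) + m * (l / 6 + 200 * r) + 506 * m * (l + r))
    (c₂ := 962 * m * (l + r) + m * (l / 6 + 200 * r) + 506 * m * (l + r)) ?_ ?_ ?_
  · refine (lintegral_tripleIntegral_le (t := fun P Q => hellingerTest (p P) (p Q)) htest π hAm hBm
      _ (hexpm (-(20 * m * R)) (m / 6)) (hexpm0 (m / 6))
      (ENNReal.ofReal (Real.exp (506 * m * (l + r)))) ?_).trans ?_
    · intro P hP Q' Q hQ
      refine (hmom _ _ (by norm_num) (by norm_num) (by norm_num) P Q Q').trans ?_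
      rw [← ENNReal.ofReal_mul (Real.exp_pos _).le, ← ENNReal.ofReal_mul (Real.exp_pos _).le,
        ← Real.exp_add, ← Real.exp_add]
      refine ENNReal.ofReal_le_ofReal (Real.exp_le_exp.mpr ?_)
      have hP' : R < hellingerSq S (law P) := hP
      have hQ1 := hball Q hQ
      have h0 := hellingerSq_nonneg S (law Q')
      have h1 := hellingerSq_nonneg S (law Q)
      rw [hnm]
      -- The coefficient of h²(S,P) is about 2 − (3/16)·126 + 0.5, below −20 − 1/6: the 20 is spent
      -- on `R`, the 1/6 kept for integrability against the prior. The coefficient of h²(S,Q) is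
      -- below 253, doubled to 506 by `hball`.
      have key : 62500 * (1 / 125 * (1 / 500) * (2 * hellingerSq S (law P)
            - 3 / 16 * hellingerSq S (law Q'))
          + (1 + 1 / 125) * (1 / 500) * (2 * hellingerSq S (law Q)
            - 3 / 16 * hellingerSq S (law P))
          + 2 * (1 / 125 * (1 / 500)) ^ 2 * (hellingerSq S (law P) + hellingerSq S (law Q'))
          + 2 * ((1 + 1 / 125) * (1 / 500)) ^ 2 * (hellingerSq S (law P) + hellingerSq S (law Q)))
          ≤ -(20 * R) - hellingerSq S (law P) / 6 - hellingerSq S (law Q') / 6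
            + 506 * (l + r) := by
        linarith
      have := mul_le_mul_of_nonneg_left key hm0.le
      linarith
    · have hF : ∫⁻ P in {P | R < hellingerSq S (law P)}, ENNReal.ofReal
          (Real.exp (-(20 * m * R) + -(m / 6 * hellingerSq S (law P)))) ∂π ≤
          ENNReal.ofReal (Real.exp (-(20 * m * R)) *
            (π.real B * Real.exp (m * (l / 6 + 200 * r)))) := by
        refine (setLIntegral_le_lintegral _ _).trans ?_
        simp_rw [Real.exp_add, ENNReal.ofReal_mul (Real.exp_pos (-(20 * m * R))).le]
        rw [lintegral_const_mul' _ _ ENNReal.ofReal_ne_top]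
        exact mul_le_mul_right hJ _
      refine (mul_le_mul' hF (mul_le_mul_left hJ _)).trans (le_of_eq ?_)
      rw [← hofB, ← ENNReal.ofReal_mul (by positivity), ← ENNReal.ofReal_mul (by positivity),
        ← ENNReal.ofReal_mul (by positivity), Real.exp_add, Real.exp_add, Real.exp_add]
      congr 1
      ring
  · refine (lintegral_tripleIntegral_le (t := fun P Q => hellingerTest (p P) (p Q)) htest π hBm hBm
      _ (F := fun _ => ENNReal.ofReal (Real.exp (962 * m * (l + r)))) measurable_const
      (hexpm0 (m / 6)) (ENNReal.ofReal (Real.exp (506 * m * (l + r)))) ?_).trans ?_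
    · intro P hP Q' Q hQ
      refine (hmom _ _ (by norm_num) (by norm_num) (by norm_num) P Q Q').trans ?_
      rw [← ENNReal.ofReal_mul (Real.exp_pos _).le, ← ENNReal.ofReal_mul (Real.exp_pos _).le,
        ← Real.exp_add, ← Real.exp_add]
      refine ENNReal.ofReal_le_ofReal (Real.exp_le_exp.mpr ?_)
      have hP1 := hball P hP
      have hQ1 := hball Q hQ
      have h0 := hellingerSq_nonneg S (law Q')
      rw [hnm]
      -- Here `P` also lies in `B`: its coefficient is below 481, doubled to 962.
      have key : 62500 * ((2 + 1 / 125) * (1 / 500) * (2 * hellingerSq S (law P)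
            - 3 / 16 * hellingerSq S (law Q'))
          + (1 + 1 / 125) * (1 / 500) * (2 * hellingerSq S (law Q)
            - 3 / 16 * hellingerSq S (law P))
          + 2 * ((2 + 1 / 125) * (1 / 500)) ^ 2 * (hellingerSq S (law P) + hellingerSq S (law Q'))
          + 2 * ((1 + 1 / 125) * (1 / 500)) ^ 2 * (hellingerSq S (law P) + hellingerSq S (law Q)))
          ≤ 962 * (l + r) - hellingerSq S (law Q') / 6 + 506 * (l + r) := by
        linarith
      have := mul_le_mul_of_nonneg_left key hm0.le
      linarith
    · rw [setLIntegral_const]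
      refine (mul_le_mul_right (mul_le_mul_left hJ _) _).trans (le_of_eq ?_)
      rw [← hofB, ← ENNReal.ofReal_mul (by positivity), ← ENNReal.ofReal_mul (by positivity),
        ← ENNReal.ofReal_mul (by positivity), ← ENNReal.ofReal_mul (by positivity),
        Real.exp_add, Real.exp_add]
      congr 1
      ring
  -- The gain 20·847 = 16940 per unit of m(l + r) far exceeds the total cost, at most 2574. The ξ
  -- part of `R` likewise absorbs 3ξ/2.
  · have h1 : m * R = 847 * (m * (l + r)) + 1694 * (m * (5334 * ξ / n)) := by rw [hR]; ring
    rw [hmξ] at h1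
    have h2 : 0 ≤ m * l := by positivity
    have h3 : 0 ≤ m * r := by positivity
    linarith

/-- Works through a cover of the complement, so `s` itself need not be measurable. -/
theorem one_sub_le_measureReal_of_compl_le {α : Type*} [MeasurableSpace α] (ν : Measure α)
    [IsProbabilityMeasure ν] {s N : Set α} (h : sᶜ ⊆ N) {a : ℝ} (ha : 0 ≤ a)
    (hN : ν N ≤ ENNReal.ofReal a) : 1 - a ≤ ν.real s := by
  have h1 : ν.real Set.univ ≤ ν.real s + ν.real N := by
    refine (measureReal_mono (s₂ := s ∪ N) fun x _ => ?_).trans (measureReal_union_le _ _)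
    by_cases hx : x ∈ s
    · exact Or.inl hx
    · exact Or.inr (h hx)
  have h2 : ν.real N ≤ a := ENNReal.toReal_le_of_le_ofReal ha hN
  rw [probReal_univ] at h1
  linarith

end

end HellingerPosterior

theorem corollary2
    -- the observation space, the sample size, the sample and its marginals
    {E : Type*} [MeasurableSpace E]
    {Ω : Type*} [MeasurableSpace Ω] (Pr : Measure Ω) [IsProbabilityMeasure Pr]
    (n : ℕ) (hn : 0 < n)
    (Pstar : Fin n → Measure E) [∀ i, IsProbabilityMeasure (Pstar i)]
    (X : Fin n → Ω → E) (hXlaw : ∀ i, HasLaw (X i) (Pstar i) Pr) (hXind : iIndepFun X Pr)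
    -- the model: probabilities `law P = p P · μ` for `P : 𝓜`, with a σ-algebra and a prior on `𝓜`
    {𝓜 : Type*} [MeasurableSpace 𝓜] (π : Measure 𝓜) [IsProbabilityMeasure π]
    (law : 𝓜 → Measure E) [∀ P, IsProbabilityMeasure (law P)]
    (μ : Measure E) (p : 𝓜 → E → ℝ≥0) (hp : ∀ P, Measurable (p P))
    (hlaw : ∀ P, law P = μ.withDensity fun x => (p P x : ℝ≥0∞))
    -- measurability of the loss and of the tests
    (hloss : ∀ S : Measure E, IsProbabilityMeasure S →
      Measurable fun P => HellingerPosterior.hellingerSq S (law P))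
    (htest : Measurable fun z : E × 𝓜 × 𝓜 =>
      HellingerPosterior.hellingerTest (p z.2.1) (p z.2.2) z.1)
    (ξ : ℝ) (hξ : 0 < ξ) :
    (∀ x : Fin n → E, IsProbabilityMeasure
      (HellingerPosterior.posterior (fun P Q => HellingerPosterior.hellingerTest (p P) (p Q))
        (1 / 500) (1 / 125) π x)) ∧
    1 - 2 * Real.exp (-ξ / 2) ≤
      Pr.real {ω | 1 - Real.exp (-ξ / 2) ≤
        (HellingerPosterior.posterior (fun P Q => HellingerPosterior.hellingerTest (p P) (p Q))
            (1 / 500) (1 / 125) π (fun i => X i ω)).real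
          {Phat | ENNReal.ofReal
              (HellingerPosterior.hellingerSq (HellingerPosterior.avgMeasure Pstar) (law Phat)) ≤
            1694 * ((⨅ P : 𝓜, (ENNReal.ofReal
                (HellingerPosterior.hellingerSq (HellingerPosterior.avgMeasure Pstar) (law P)) +
                HellingerPosterior.hellingerRadius law π n P)) +
              ENNReal.ofReal (5334 * ξ / (n : ℝ)))}} := by
  have hprob : ∀ x : Fin n → E, IsProbabilityMeasure (HellingerPosterior.posterior
      (fun P Q => HellingerPosterior.hellingerTest (p P) (p Q)) (1 / 500) (1 / 125) π x) :=
    HellingerPosterior.isProbabilityMeasure_posterior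
      (t := fun P Q => HellingerPosterior.hellingerTest (p P) (p Q)) htest
      (fun P Q x => HellingerPosterior.abs_hellingerTest_le (p P) (p Q) x) _ _ π
  refine ⟨hprob, ?_⟩
  by_cases hW : (⨅ P : 𝓜, (ENNReal.ofReal
      (HellingerPosterior.hellingerSq (HellingerPosterior.avgMeasure Pstar) (law P)) +
      HellingerPosterior.hellingerRadius law π n P)) = ⊤
  · rw [hW, top_add, ENNReal.mul_top (by norm_num)]
    refine HellingerPosterior.one_sub_le_measureReal_of_compl_le Pr (N := ∅) ?_ (by positivity)
      (by simp)
    rw [Set.compl_subset_comm]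
    intro ω _
    have := hprob fun i => X i ω
    exact HellingerPosterior.one_sub_le_measureReal_of_compl_le _ (N := ∅) (by simp)
      (Real.exp_pos _).le (by simp)
  -- The factor 2 lost to near-minimality turns 847 into 1694.
  obtain ⟨P₀, r, hr, hratio, hlt⟩ :=
    HellingerPosterior.exists_radius_lt law π (HellingerPosterior.avgMeasure Pstar) hn hW
  obtain ⟨N, hNm, hN, hpost⟩ := HellingerPosterior.exists_posterior_far_le hn Pstar π law μ p hp
    hlaw hloss htest hξ P₀ hr hratio
  have hXm : AEMeasurable (fun ω i => X i ω) Pr :=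
    aemeasurable_pi_lambda _ fun i => (hXlaw i).aemeasurable
  have hmap : Pr.map (fun ω i => X i ω) = Measure.pi Pstar := by
    rw [(iIndepFun_iff_map_fun_eq_pi_map fun i => (hXlaw i).aemeasurable).mp hXind]
    simp_rw [(hXlaw _).map_eq]
  rw [← hmap, Measure.map_apply_of_aemeasurable hXm hNm] at hN
  refine HellingerPosterior.one_sub_le_measureReal_of_compl_le Pr ?_ (by positivity) hN
  rw [Set.compl_subset_comm]
  intro ω hω
  have := hprob fun i => X i ω
  refine HellingerPosterior.one_sub_le_measureReal_of_compl_le _ ?_ (Real.exp_pos _).le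
    (hpost (fun i => X i ω) hω)
  intro P hP
  by_contra hP'
  refine hP ?_
  simp only [Set.mem_ofPred_eq, not_lt] at hP' ⊢
  have hl := HellingerPosterior.hellingerSq_nonneg (HellingerPosterior.avgMeasure Pstar) (law P₀)
  have hn' : (0 : ℝ) < n := by exact_mod_cast hn
  have hr0 : 0 < r := lt_of_lt_of_le (by positivity) hr
  refine (ENNReal.ofReal_le_ofReal hP').trans ?_
  rw [ENNReal.ofReal_add (by positivity) (by positivity), ENNReal.ofReal_mul (by norm_num),
    ENNReal.ofReal_mul (by norm_num), ENNReal.ofReal_add hl hr0.le, mul_add 1694]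
  refine add_le_add ?_ (le_of_eq (by congr 1; norm_num))
  refine (mul_le_mul_right hlt.le _).trans (le_of_eq ?_)
  rw [← mul_assoc]
  congr 1
  norm_num
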